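/- Let $\beta\in\mathbb{C}\setminus\{0\}$ with $\beta^{-1}\notin\mathbb{Z}$, let $K$ be a field extension of $\mathbb{C}$ (for instance $K=\mathbb{C}$, or $K=\mathbb{C}(\tilde t_1,\tilde t_2,\dots)$ with independent variables $\tilde t_m$), and let $\tilde{\mathbf t}=(\tilde t_1,\tilde t_2,\dots)$ be any sequence of elements of $K$. For times $\mathbf t=(t_1,t_2,\dots)$ put $\sum_{n}h_n(\mathbf t)x^n=\exp\big(\sum_{m\ge1}t_mx^m\big)$, $h_n=0$ for $n<0$, and $s_\lambda(\mathbf t)=\det\big(h_{\lambda_i-i+j}(\mathbf t)\big)_{1\le i,j\le\ell(\lambda)}$. The generating function of double monotone Hurwitz numbers is $$\tau_{mm}(\mathbf t,\tilde{\mathbf t})=\sum_\lambda s_\lambda(\mathbf t)\,s_\lambda(\tilde{\mathbf t})\prod_{i=1}^{\ell(\lambda)}\prod_{k=0}^{\lambda_i-1}\frac{1}{1+\beta(k+i-\lambda_i)}\in K[[\mathbf t]].$$ The (charge zero) Sato Grassmannian consists of the subspaces $W\subset K((x))$ for which the projection $W\to K((x))/xK[[x]]$ has finite-dimensional kernel and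 cokernel of equal dimension. An admissible basis of $W$ is a $K$-basis $w_1,w_2,\dots$ of $W$ for which there is an $N\ge0$ such that $w_k\in x^{1-k}+x^{2-k}K[[x]]$ for all $k>N$ and $w_k\in x^{1-N}K[[x]]$ for all $k\le N$. A tau-function of $W$ is a series $$\langle0|\exp\Big(\sum_{i\ge1}t_i\alpha_i\Big)\,w_1\wedge w_2\wedge w_3\wedge\cdots\in K[[\mathbf t]]$$ for an admissible basis of $W$ (it is determined by $W$ up to a nonzero factor). Here $\alpha_i=\sum_{j\in\mathbb Z}\psi_{j-i}\psi_j^*$ with $\psi_j=x^j\wedge$ and $\psi_j^*=\partial/\partial(x^j)$ on the semi-infinite wedge space, $|0\rangle=x^0\wedge x^{-1}\wedge x^{-2}\wedge\cdots$, and $\langle0|$ takes the coefficient of $|0\rangle$. For $k\ge1$ let $$\Phi_k^{mm}(x)=G_{mm}(k)\,e^{\sum_{m\ge1}\tilde t_mx^m}\,x^{1-k}\in K((x)),\qquad G_{mm}(k)=\frac{\Gamma(1-k-\beta^{-1})\,(-\beta)^{1-k-D}}{\Gamma(D-\beta^{-1})},\quad D=x\frac{\partial}{\partial x},$$ where a function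 $g(D)$ of $D$ acts on $K((x))$ by multiplying $x^m$ by $g(m)$. Then, for every $k\ge 1$, $\Phi_k^{mm}(x)=x^{1-k}+(\text{higher powers of }x)$; the $\Phi_k^{mm}$, $k\ge1$, form an admissible basis of their span $\langle\Phi^{mm}\rangle$, which is a point of the Sato Grassmannian; and $$\tau_{mm}(\mathbf t,\tilde{\mathbf t})=\langle0|\exp\Big(\sum_{i\ge1}t_i\alpha_i\Big)\,\Phi_1^{mm}\wedge\Phi_2^{mm}\wedge\Phi_3^{mm}\wedge\cdots.$$ Moreover $\langle\Phi^{mm}\rangle$ is the point of the Sato Grassmannian corresponding to $\tau_{mm}$: a point $W$ of the Sato Grassmannian has $\tau_{mm}(\cdot,\tilde{\mathbf t})$ as a tau-function if and only if $W=\langle\Phi^{mm}\rangle$. -/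

import Mathlib

open scoped Classical in
/-- The value at which a sequence becomes constant (`0` if it never does). -/
noncomputable def eventualValue {A : Type*} [Zero A] (u : ℕ → A) : A :=
  if h : ∃ c, ∀ᶠ N in Filter.atTop, u N = c then h.choose else 0

theorem eventualValue_eq {A : Type*} [Zero A] {u : ℕ → A} {c : A}
    (h : ∀ᶠ N in Filter.atTop, u N = c) : eventualValue u = c := by
  have hex : ∃ c, ∀ᶠ N in Filter.atTop, u N = c := ⟨c, h⟩
  unfold eventualValue
  rw [dif_pos hex]
  obtain ⟨N, h1, h2⟩ := (hex.choose_spec.and h).exists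
  exact h1.symm.trans h2

section SemiInfiniteWedge

/-- Index set of the standard basis of the semi-infinite wedge space `V`: the semi-infinite monomial
`z^{s₁} ∧ z^{s₂} ∧ ⋯` with `s₁ > s₂ > ⋯` is encoded by the set `{s₁, s₂, …} ⊆ ℤ` of its exponents,
which contains all but finitely many nonpositive and only finitely many positive integers. -/
def Maya : Type := {S : Set ℤ // (S ∩ Set.Ioi 0).Finite ∧ (Set.Iic 0 \ S).Finite}

namespace Maya

/-- Add the exponent `i`. -/
def insert (i : ℤ) (S : Maya) : Maya :=
  ⟨Insert.insert i S.1, by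
    refine ⟨(S.2.1.insert i).subset ?_, S.2.2.subset ?_⟩
    · rintro x ⟨rfl | hx, hx0⟩
      · exact Set.mem_insert _ _
      · exact Set.mem_insert_of_mem _ ⟨hx, hx0⟩
    · rintro x ⟨hx0, hx⟩
      exact ⟨hx0, fun h => hx (Set.mem_insert_of_mem _ h)⟩⟩

/-- Remove the exponent `i`. -/
def erase (i : ℤ) (S : Maya) : Maya :=
  ⟨S.1 \ {i}, by
    refine ⟨S.2.1.subset ?_, (S.2.2.insert i).subset ?_⟩
    · rintro x ⟨⟨hx, -⟩, hx0⟩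
      exact ⟨hx, hx0⟩
    · rintro x ⟨hx0, hx⟩
      by_cases h : x = i
      · exact h ▸ Set.mem_insert _ _
      · exact Set.mem_insert_of_mem _ ⟨hx0, fun h' => hx ⟨h', h⟩⟩⟩

/-- The number of factors `z^j` with `j > i`, i.e. the number of factors standing to the left of
the place of `z^i`. It is finite. -/
noncomputable def above (i : ℤ) (S : Maya) : ℕ := {j ∈ S.1 | i < j}.ncard

/-- The exponents `λ₁ - 0, λ₂ - 1, λ₃ - 2, …` of the basis vector
`v_λ = z^{λ₁} ∧ z^{λ₂ - 1} ∧ z^{λ₃ - 2} ∧ ⋯`; rows of a `YoungDiagram` are numbered from `0`. -/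
def ofDiagram (lam : YoungDiagram) : Maya :=
  ⟨Set.range fun i : ℕ => (lam.rowLen i : ℤ) - i, by
    constructor
    · refine ((Set.finite_lt_nat (lam.rowLen 0)).image
        (fun i : ℕ => (lam.rowLen i : ℤ) - i)).subset ?_
      rintro x ⟨⟨i, rfl⟩, hx⟩
      refine ⟨i, ?_, rfl⟩
      have h := lam.rowLen_anti 0 i (Nat.zero_le i)
      simp only [Set.mem_Ioi, Set.mem_ofPred_eq] at hx ⊢
      omega
    · refine (Set.finite_Icc (-(lam.colLen 0 : ℤ)) 0).subset ?_
      rintro x ⟨hx0, hx⟩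
      simp only [Set.mem_Iic] at hx0
      refine ⟨?_, hx0⟩
      by_contra hlt
      push Not at hlt
      apply hx
      refine ⟨(-x).toNat, ?_⟩
      have h0 : lam.rowLen (-x).toNat = 0 := by
        by_contra hne
        have h1 : ((-x).toNat, 0) ∈ lam := YoungDiagram.mem_iff_lt_rowLen.2 (by omega)
        have h2 := YoungDiagram.mem_iff_lt_colLen.1 h1
        omega
      simp only [h0]
      omega⟩

end Maya

variable (K : Type*) [Field K]

/-- The semi-infinite wedge space `V`. -/
abbrev Wedge : Type _ := Maya →₀ K

open scoped Classical in
/-- `ψ_i = z^i ∧ ·`. -/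
noncomputable def psi (i : ℤ) : Module.End K (Wedge K) :=
  Finsupp.linearCombination K fun S : Maya =>
    if i ∈ S.1 then (0 : Wedge K) else Finsupp.single (S.insert i) ((-1) ^ S.above i)

open scoped Classical in
/-- `ψ_i^* = ∂ / ∂(z^i)`. -/
noncomputable def psiStar (i : ℤ) : Module.End K (Wedge K) :=
  Finsupp.linearCombination K fun S : Maya =>
    if i ∈ S.1 then Finsupp.single (S.erase i) ((-1) ^ S.above i) else (0 : Wedge K)

/-- `α_n = ∑_{i ∈ ℤ} ψ_{i-n} ψ_i^*` for `n > 0` (normal ordering changes nothing for `n ≠ 0`). On each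
basis vector only finitely many summands do not vanish. -/
noncomputable def alpha (n : ℕ+) : Module.End K (Wedge K) :=
  Finsupp.linearCombination K fun S : Maya =>
    ∑ᶠ i : ℤ, psi K (i - n) (psiStar K i (Finsupp.single S 1))

/-- `∑_{i ≥ 1} t_i α_i`, as a power series in `t₁, t₂, …` with coefficients in `End V`. -/
noncomputable def alphaSeries : MvPowerSeries ℕ+ (Module.End K (Wedge K)) := fun m =>
  ∑ i ∈ m.support, if m = Finsupp.single i 1 then alpha K i else 0

/-- `exp (∑_{i ≥ 1} t_i α_i) = ∑_r (∑_i t_i α_i)^r / r!`. Only the `r`-th summand contributes to the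
coefficients of monomials of total degree `r` (each `t_i` having degree one). -/
noncomputable def expAlpha : MvPowerSeries ℕ+ (Module.End K (Wedge K)) := fun m =>
  (m.degree.factorial : K)⁻¹ • MvPowerSeries.coeff m (alphaSeries K ^ m.degree)

/-- The power series `⟨0| exp (∑ t_i α_i) v_λ ∈ K[[t]]`. -/
noncomputable def fermionToBoson (lam : YoungDiagram) : MvPowerSeries ℕ+ K := fun m =>
  (MvPowerSeries.coeff m (expAlpha K) (Finsupp.single (Maya.ofDiagram lam) 1))
    (Maya.ofDiagram ⊥)

variable {K}

/-- The series `⟨0| exp (∑ t_i α_i) v` of a vector `v = ∑_λ c_λ v_λ` of charge zero, where infinitely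
many `c_λ` may be nonzero. The sum is taken coefficientwise; as `⟨0| exp (∑ t_i α_i) v_λ` is
homogeneous of degree `|λ|` if `t_i` has degree `i`, each coefficient is a finite sum. -/
noncomputable def bosonize (c : YoungDiagram → K) : MvPowerSeries ℕ+ K := fun m =>
  ∑ᶠ lam : YoungDiagram, c lam * MvPowerSeries.coeff m (fermionToBoson K lam)

/-- The vector `w₁ ∧ w₂ ∧ w₃ ∧ ⋯` (with `w_{j+1}` written `w j`): its coefficient at `v_λ` is the stable
value of the `N × N` minor on the exponents `λ₁, λ₂ - 1, …, λ_N - N + 1`. -/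
noncomputable def infiniteWedge (w : ℕ → LaurentSeries K) (lam : YoungDiagram) : K :=
  eventualValue fun N : ℕ =>
    (Matrix.of fun i j : Fin N => (w j).coeff ((lam.rowLen i : ℤ) - (i : ℕ))).det

end SemiInfiniteWedge

section Grassmannian

variable (K : Type*) [Field K]

/-- `x K[[x]]` inside `K((x))`. -/
noncomputable def positivePart : Submodule K (LaurentSeries K) where
  carrier := {f | ∀ m : ℤ, m ≤ 0 → f.coeff m = 0}
  add_mem' := by
    intro f g hf hg m hm
    simp [hf m hm, hg m hm]
  zero_mem' := by
    intro m _
    simp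
  smul_mem' := by
    intro c f hf m hm
    simp [hf m hm]

variable {K}

/-- The projection of `W ⊆ K((x))` to `K((x)) / x K[[x]]`. -/
noncomputable def grProj (W : Submodule K (LaurentSeries K)) :
    W →ₗ[K] LaurentSeries K ⧸ positivePart K :=
  (positivePart K).mkQ ∘ₗ W.subtype

variable (K) in
/-- The Sato Grassmannian (of charge zero): the subspaces `W` of `K((x))` whose projection to
`K((x)) / x K[[x]]` has finite-dimensional kernel and cokernel, of the same dimension. -/
def SatoGrassmannian : Set (Submodule K (LaurentSeries K)) :=
  {W | FiniteDimensional K (LinearMap.ker (grProj W)) ∧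
    FiniteDimensional K ((LaurentSeries K ⧸ positivePart K) ⧸ LinearMap.range (grProj W)) ∧
    Module.finrank K (LinearMap.ker (grProj W)) =
      Module.finrank K ((LaurentSeries K ⧸ positivePart K) ⧸ LinearMap.range (grProj W))}

/-- `w₁, w₂, …` (with `w_{k+1}` written `w k`) is an admissible basis of `W`: a basis with
`w_k = x^{1-k} + (higher powers)` for all large `k`, the remaining finitely many vectors being
compatible with this, so that `w₁ ∧ w₂ ∧ ⋯` makes sense and has charge zero. -/
def IsAdmissibleBasis (w : ℕ → LaurentSeries K) (W : Submodule K (LaurentSeries K)) : Prop :=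
  LinearIndependent K w ∧ Submodule.span K (Set.range w) = W ∧
    ∃ N : ℕ,
      (∀ k, N ≤ k → (w k).coeff (-(k : ℤ)) = 1 ∧ ∀ m : ℤ, m < -(k : ℤ) → (w k).coeff m = 0) ∧
      (∀ k, k < N → ∀ m : ℤ, m ≤ -(N : ℤ) → (w k).coeff m = 0)

/-- `τ(t)` is a tau-function of the point `W`: `τ(t) = ⟨0| exp (∑ t_i α_i) w₁ ∧ w₂ ∧ ⋯` for some
admissible basis of `W`. It is determined by `W` up to a nonzero factor. -/
def IsTauFunction (τ : MvPowerSeries ℕ+ K) (W : Submodule K (LaurentSeries K)) : Prop :=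
  ∃ w : ℕ → LaurentSeries K, IsAdmissibleBasis w W ∧ τ = bosonize (infiniteWedge w)

end Grassmannian

section Schur

variable {A : Type*} [CommRing A] [Algebra ℂ A]

/-- `exp (∑_{m ≥ 1} t_m x^m) ∈ A[[x]]`. -/
noncomputable def expTimes (t : ℕ+ → A) : PowerSeries A :=
  (PowerSeries.exp ℂ).subst
    (PowerSeries.mk fun n : ℕ => if h : 0 < n then t ⟨n, h⟩ else 0 : PowerSeries A)

/-- `h_n(t)`, where `∑_n h_n(t) x^n = exp (∑_m t_m x^m)`, and `h_n = 0` for `n < 0`. -/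
noncomputable def completeHomogeneous (t : ℕ+ → A) (n : ℤ) : A :=
  if 0 ≤ n then PowerSeries.coeff n.toNat (expTimes t) else 0

/-- The Schur function `s_λ(t) = det (h_{λ_i - i + j}(t))`, in the variables `t_k = p_k / k`. -/
noncomputable def schurFunction (t : ℕ+ → A) (lam : YoungDiagram) : A :=
  (Matrix.of fun i j : Fin (lam.colLen 0) =>
    completeHomogeneous t ((lam.rowLen i : ℤ) - (i : ℕ) + (j : ℕ))).det

end Schur

section DoubleMonotone

/-- `∏_{i=1}^{ℓ(λ)} ∏_{k=0}^{λ_i - 1} 1 / (1 + β (k + i - λ_i))`; the row of number `i` is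
`lam.rowLen (i - 1)`. -/
noncomputable def monotoneWeight (β : ℂ) (lam : YoungDiagram) : ℂ :=
  ∏ i ∈ Finset.Icc 1 (lam.colLen 0), ∏ k ∈ Finset.range (lam.rowLen (i - 1)),
    1 / (1 + β * ((k : ℂ) + (i : ℂ) - (lam.rowLen (i - 1) : ℂ)))

variable {K : Type*} [Field K] [Algebra ℂ K]

/-- `τ_mm(t, t̃) = ∑_λ s_λ(t) s_λ(t̃) ∏_i ∏_k 1 / (1 + β (k + i - λ_i))` as a power series in
`t₁, t₂, …`, where `t̃` (written `tt`) is a sequence of elements of `K`. The sum is taken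
coefficientwise and is finite in each coefficient, as `s_λ(t)` is homogeneous of degree `|λ|`. -/
noncomputable def tauMM (β : ℂ) (tt : ℕ+ → K) : MvPowerSeries ℕ+ K := fun m =>
  ∑ᶠ lam : YoungDiagram,
    MvPowerSeries.coeff m
        (schurFunction (fun i : ℕ+ => (MvPowerSeries.X i : MvPowerSeries ℕ+ K)) lam) *
      schurFunction tt lam * algebraMap ℂ K (monotoneWeight β lam)

/-- The operator `g(D)` on `K((x))`, where `D = x ∂/∂x`: it multiplies `x^m` by `g(m)`. -/
noncomputable def funcOfD (g : ℤ → K) (f : LaurentSeries K) : LaurentSeries K where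
  coeff m := g m * f.coeff m
  isPWO_support' := f.isPWO_support.mono fun m hm => by
    simp only [Function.mem_support] at hm
    exact right_ne_zero_of_mul hm

/-- The value of `G_mm(k) = Γ(1 - k - β⁻¹) (-β)^{1-k-D} / Γ(D - β⁻¹)` at `D = m`. -/
noncomputable def gMM (β : ℂ) (k m : ℤ) : ℂ :=
  Complex.Gamma (1 - (k : ℂ) - β⁻¹) * (-β) ^ (1 - k - m) / Complex.Gamma ((m : ℂ) - β⁻¹)

/-- `Φ_k^{mm}(x) = G_mm(k) e^{∑ t̃_m x^m} x^{1-k}`. -/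
noncomputable def PhiMM (β : ℂ) (tt : ℕ+ → K) (k : ℕ) : LaurentSeries K :=
  funcOfD (fun m : ℤ => algebraMap ℂ K (gMM β k m))
    (HahnSeries.ofPowerSeries ℤ K (expTimes tt) * HahnSeries.single (1 - (k : ℤ)) 1)

end DoubleMonotone

/-! ### Complete homogeneous functions: the recursion and derivatives in the times -/

section CompleteHomogeneous

/-! Put c(m) = (-β)^{-m} / Γ(m - β⁻¹). The operator G_mm(k) multiplies x^m by c(m) / c(1-k)
(`gMM_eq`). Counting rows and columns from 0, the coefficient of Φ_{j+1} at x^{λ_i - i} is therefore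
c(λ_i - i) h_{λ_i - i + j}(t̃) / c(-j): a Jacobi-Trudi matrix with rescaled rows and columns, whose
determinant is s_λ(t̃) ∏ c(λ_i - i) / c(-i). The functional equation of Γ gives c(m+1) = c(m) / (1 -
βm), which turns the last product into the weight in τ_mm (`infiniteWedge_PhiMM`).

The formula for τ_mm is then the boson-fermion correspondence ⟨0| exp(∑ t_i α_i) v_λ = s_λ(t)
(`fermionToBoson_eq_schurFunction`). Both α_i on a wedge of powers of x and ∂/∂t_i on det(h_{s_k +
j}) sum over the ways of lowering one exponent s_k by i. The values at t = 0 agree, and Euler's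
identity for the degree in t carries the agreement to all coefficients.

For uniqueness, Schur functions are homogeneous and linearly independent, so a tau-function
determines every Plücker coordinate of the wedge (`bosonize_injective`). The coordinate at the empty
diagram is 1, hence nonzero, and Cramer's rule then recovers the subspace from this coordinate and
those at hooks (`span_eq_of_infiniteWedge_eq`). Membership in the Grassmannian comes from the
leading terms x^{1-k}, which make the projection bijective. -/

theorem Derivation.map_prod {R A ι : Type*} [CommRing R] [CommRing A] [Algebra R A] [DecidableEq ι]
    (D : Derivation R A A) (s : Finset ι) (f : ι → A) :
    D (∏ i ∈ s, f i) = ∑ k ∈ s, ∏ i ∈ s, Function.update f k (D (f k)) i := by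
  induction s using Finset.induction_on with
  | empty => simp
  | insert a s ha ih =>
    rw [Finset.prod_insert ha, D.leibniz, Finset.sum_insert ha, Finset.prod_insert ha, ih,
      smul_eq_mul, smul_eq_mul, add_comm, Finset.mul_sum]
    congr 1
    · rw [Function.update_self, mul_comm, Finset.prod_update_of_notMem ha]
    · refine Finset.sum_congr rfl fun k hk => ?_
      rw [Finset.prod_insert ha, Function.update_of_ne (by rintro rfl; exact ha hk)]

theorem Derivation.map_det {R A : Type*} [CommRing R] [CommRing A] [Algebra R A] {n : ℕ}
    (D : Derivation R A A) (M : Matrix (Fin n) (Fin n) A) :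
    D M.det = ∑ k, (M.updateRow k fun j => D (M k j)).det := by
  simp only [Matrix.det_apply, map_sum]
  rw [Finset.sum_comm]
  refine Finset.sum_congr rfl fun σ _ => ?_
  rw [← Finset.smul_sum, Units.smul_def, Units.smul_def, map_zsmul, Derivation.map_prod]
  congr 1
  -- The Leibniz rule labels the differentiated factor by its column; σ relabels it by its row.
  rw [← Equiv.sum_comp σ fun k => ∏ i, M.updateRow k (fun j => D (M k j)) (σ i) i]
  refine Finset.sum_congr rfl fun k _ => Finset.prod_congr rfl fun i _ => ?_
  by_cases h : i = k
  · subst h; simp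
  · rw [Function.update_of_ne h, Matrix.updateRow_ne fun h' => h (σ.injective h')]

variable {A : Type*} [CommRing A] [Algebra ℂ A]

theorem intCast_mul_cancel {n : ℤ} (hn : n ≠ 0) {a b : A} (h : (n : A) * a = n * b) : a = b := by
  have hu : IsUnit (n : A) := by
    have : IsUnit (n : ℂ) := (Int.cast_ne_zero.2 hn).isUnit
    simpa using this.map (algebraMap ℂ A)
  exact hu.mul_left_cancel h

/-- The exponent `∑ t_m x^m`. -/
noncomputable def timesSeries {A : Type*} [CommRing A] (t : ℕ+ → A) : PowerSeries A :=
  PowerSeries.mk fun n : ℕ => if h : 0 < n then t ⟨n, h⟩ else 0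

theorem timesSeries_hasSubst {A : Type*} [CommRing A] (t : ℕ+ → A) :
    PowerSeries.HasSubst (timesSeries t) :=
  PowerSeries.HasSubst.of_constantCoeff_zero' (by simp [timesSeries])

theorem expTimes_eq (t : ℕ+ → A) :
    expTimes t = ((PowerSeries.exp ℂ).map (algebraMap ℂ A)).subst (timesSeries t) := by
  ext n
  change PowerSeries.coeff n ((PowerSeries.exp ℂ).subst (timesSeries t)) = _
  rw [PowerSeries.coeff_subst' (timesSeries_hasSubst t),
    PowerSeries.coeff_subst' (timesSeries_hasSubst t)]
  refine finsum_congr fun d => ?_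
  rw [PowerSeries.coeff_map, algebraMap_smul]

theorem derivative_expTimes (t : ℕ+ → A) :
    PowerSeries.derivative A (expTimes t) =
      expTimes t * PowerSeries.derivative A (timesSeries t) := by
  rw [expTimes_eq, PowerSeries.derivative_subst (timesSeries_hasSubst t)]
  congr 2
  ext n
  have h : PowerSeries.coeff (n + 1) (PowerSeries.exp ℂ) * (n + 1) =
      PowerSeries.coeff n (PowerSeries.exp ℂ) := by
    conv_rhs => rw [← PowerSeries.derivative_exp, PowerSeries.coeff_derivative]
  rw [PowerSeries.coeff_derivative, PowerSeries.coeff_map, PowerSeries.coeff_map, ← h, map_mul]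
  simp

theorem coeff_zero_expTimes (t : ℕ+ → A) : PowerSeries.coeff 0 (expTimes t) = 1 := by
  change PowerSeries.coeff 0 ((PowerSeries.exp ℂ).subst (timesSeries t)) = _
  rw [PowerSeries.coeff_subst' (timesSeries_hasSubst t), finsum_eq_single _ 0]
  · simp
  · intro d hd
    simp [timesSeries, hd]

theorem completeHomogeneous_zero (t : ℕ+ → A) : completeHomogeneous t 0 = 1 := by
  simp [completeHomogeneous, coeff_zero_expTimes]

theorem completeHomogeneous_of_neg (t : ℕ+ → A) {n : ℤ} (hn : n < 0) :
    completeHomogeneous t n = 0 :=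
  if_neg (not_le.2 hn)

theorem coeff_expTimes (t : ℕ+ → A) (n : ℕ) :
    PowerSeries.coeff n (expTimes t) = completeHomogeneous t n := by
  simp [completeHomogeneous]

/-- `n h_n = ∑ m t_m h_{n-m}`. -/
theorem intCast_mul_completeHomogeneous (t : ℕ+ → A) (n : ℤ) (M : ℕ) (hM : n ≤ M) :
    (n : A) * completeHomogeneous t n =
      ∑ a ∈ Finset.range M, ((a + 1 : ℕ) : A) * t a.succPNat * completeHomogeneous t (n - 1 - a) := by
  rcases le_or_gt n 0 with hn | hn
  · rw [Finset.sum_eq_zero fun a _ => by rw [completeHomogeneous_of_neg t (by omega), mul_zero]]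
    rcases hn.lt_or_eq with hn | rfl
    · rw [completeHomogeneous_of_neg t hn, mul_zero]
    · simp
  · obtain ⟨k, rfl⟩ : ∃ k : ℕ, n = k + 1 := ⟨(n - 1).toNat, by omega⟩
    have h := congrArg (PowerSeries.coeff k) (derivative_expTimes t)
    rw [PowerSeries.coeff_derivative, PowerSeries.coeff_mul,
      ← Finset.Nat.sum_antidiagonal_swap, Finset.Nat.sum_antidiagonal_eq_sum_range_succ_mk] at h
    simp only [Prod.swap, PowerSeries.coeff_derivative, timesSeries, PowerSeries.coeff_mk,
      coeff_expTimes] at h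
    rw [← Finset.sum_subset (s₁ := Finset.range (k + 1))
      (Finset.range_subset_range.2 (by omega))]
    · push_cast at h ⊢
      rw [mul_comm, h]
      refine Finset.sum_congr rfl fun a ha => ?_
      have ha' := Finset.mem_range.1 ha
      rw [dif_pos (Nat.succ_pos a), show ((k : ℤ) + 1 - 1 - a) = ((k - a : ℕ) : ℤ) by omega]
      change _ * (t a.succPNat * _) = _
      ring
    · intro a _ ha
      rw [Finset.mem_range] at ha
      rw [completeHomogeneous_of_neg t (by omega), mul_zero]

/-- Nonzero integers are invertible in a ℂ-algebra, so the recursion determines every term. This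
replaces all manipulation of the exponential series below. -/
theorem completeHomogeneous_unique (t : ℕ+ → A) (y : ℤ → A) (h0 : y 0 = 1)
    (hneg : ∀ n < 0, y n = 0)
    (hrec : ∀ n : ℕ, ((n : ℤ) : A) * y n =
      ∑ a ∈ Finset.range n, ((a + 1 : ℕ) : A) * t a.succPNat * y (n - 1 - a)) (n : ℤ) :
    y n = completeHomogeneous t n := by
  rcases lt_or_ge n 0 with hn | hn
  · rw [hneg n hn, completeHomogeneous_of_neg t hn]
  lift n to ℕ using hn
  induction n using Nat.strong_induction_on with
  | _ n ih =>
    rcases Nat.eq_zero_or_pos n with rfl | hn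
    · exact h0.trans (completeHomogeneous_zero t).symm
    refine intCast_mul_cancel (n := n) (by omega) ?_
    rw [hrec, intCast_mul_completeHomogeneous t n n le_rfl]
    refine Finset.sum_congr rfl fun a ha => ?_
    have ha' := Finset.mem_range.1 ha
    rw [show ((n : ℤ) - 1 - a) = ((n - 1 - a : ℕ) : ℤ) by omega, ih _ (by omega)]

theorem map_completeHomogeneous {B : Type*} [CommRing B] [Algebra ℂ B] (f : A →ₐ[ℂ] B)
    (t : ℕ+ → A) (n : ℤ) :
    f (completeHomogeneous t n) = completeHomogeneous (fun i => f (t i)) n := by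
  refine completeHomogeneous_unique (fun i => f (t i)) (fun n => f (completeHomogeneous t n))
    ?_ ?_ ?_ n
  · simp [completeHomogeneous_zero]
  · intro n hn
    simp [completeHomogeneous_of_neg t hn]
  · intro n
    have h := congrArg f (intCast_mul_completeHomogeneous t n n le_rfl)
    simpa only [map_mul, map_sum, map_intCast, map_natCast] using h

theorem map_schurFunction {B : Type*} [CommRing B] [Algebra ℂ B] (f : A →ₐ[ℂ] B)
    (t : ℕ+ → A) (lam : YoungDiagram) :
    f (schurFunction t lam) = schurFunction (fun i => f (t i)) lam := by
  rw [schurFunction, schurFunction, AlgHom.map_det]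
  congr 1
  ext i j
  exact map_completeHomogeneous f t _

/-- Times with prescribed complete homogeneous functions. -/
theorem exists_completeHomogeneous_eq (y : ℕ → A) (hy : y 0 = 1) :
    ∃ t : ℕ+ → A, ∀ n : ℕ, completeHomogeneous t n = y n := by
  -- `T a` stands for t_{a+1}. The recursion for (n+1) h_{n+1} is solved for its term a = n, whose
  -- coefficient n+1 is invertible.
  obtain ⟨T, hT⟩ : ∃ T : ℕ → A, ∀ n : ℕ, ((n + 1 : ℕ) : A) * T n =
      ((n + 1 : ℕ) : A) * y (n + 1) -
        ∑ a ∈ Finset.range n, ((a + 1 : ℕ) : A) * T a * y (n - a) := by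
    let F : (n : ℕ) → ((m : ℕ) → m < n → A) → A := fun n T =>
      algebraMap ℂ A ((n + 1 : ℕ) : ℂ)⁻¹ * (((n + 1 : ℕ) : A) * y (n + 1) -
        ∑ a : Fin n, ((a + 1 : ℕ) : A) * T a a.2 * y (n - a))
    refine ⟨fun n => Nat.strongRec F n, fun n => ?_⟩
    have hF : Nat.strongRec F n = F n fun m _ => Nat.strongRec F m := by
      rw [Nat.strongRec]
    have hu : ((n + 1 : ℕ) : A) * algebraMap ℂ A ((n + 1 : ℕ) : ℂ)⁻¹ = 1 := by
      rw [← map_natCast (algebraMap ℂ A), ← map_mul,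
        mul_inv_cancel₀ (Nat.cast_ne_zero.2 n.succ_ne_zero), map_one]
    beta_reduce
    rw [hF, ← mul_assoc, hu, one_mul]
    congr 1
    exact Fin.sum_univ_eq_sum_range
      (fun a => ((a + 1 : ℕ) : A) * (Nat.strongRec F a : A) * y (n - a)) n
  refine ⟨fun i => T i.natPred, fun n => ?_⟩
  have h := completeHomogeneous_unique (fun i => T i.natPred)
    (fun n : ℤ => if 0 ≤ n then y n.toNat else 0) (by simp [hy])
    (fun n hn => if_neg (not_le.2 hn)) ?_ n
  · simpa using h.symm
  · intro n
    cases n with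
    | zero => simp
    | succ n =>
      have h := hT n
      rw [Finset.sum_range_succ]
      have h1 : ∀ a ∈ Finset.range n,
          (if (0 : ℤ) ≤ ((n + 1 : ℕ) : ℤ) - 1 - a then y (((n + 1 : ℕ) : ℤ) - 1 - a).toNat else 0)
            = y (n - a) := by
        intro a ha
        have ha' := Finset.mem_range.1 ha
        rw [if_pos (by omega)]
        congr 1
        omega
      rw [Finset.sum_congr rfl fun a ha => by rw [h1 a ha]]
      simp only [Nat.natPred_succPNat]
      have h2 : (((n + 1 : ℕ) : ℤ) - 1 - n) = 0 := by omega
      rw [h2]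
      simp only [le_refl, if_true, Int.toNat_zero, hy, mul_one, Int.toNat_natCast,
        Int.natCast_nonneg, Int.cast_natCast]
      linear_combination -h

variable {K : Type*} [Field K] [Algebra ℂ K]

/-- `∂ h_n / ∂ t_i = h_{n-i}`. -/
theorem pderiv_completeHomogeneous (i : ℕ+) (n : ℤ) :
    MvPowerSeries.pderiv K i (completeHomogeneous (A := MvPowerSeries ℕ+ K) MvPowerSeries.X n) =
      completeHomogeneous MvPowerSeries.X (n - i) := by
  obtain ⟨N, hN⟩ : ∃ N : ℕ, n ≤ N := ⟨n.toNat, by omega⟩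
  induction N using Nat.strong_induction_on generalizing n with
  | _ N ih =>
    have hi := i.pos
    rcases lt_trichotomy n 0 with hn | rfl | hn
    · rw [completeHomogeneous_of_neg _ hn, completeHomogeneous_of_neg _ (by omega), map_zero]
    · rw [completeHomogeneous_zero, completeHomogeneous_of_neg _ (by omega),
        MvPowerSeries.pderiv_one]
    refine intCast_mul_cancel (n := n) (by omega) ?_
    have h := congrArg (MvPowerSeries.pderiv K i) (intCast_mul_completeHomogeneous
      (A := MvPowerSeries ℕ+ K) MvPowerSeries.X n (N + i) (by push_cast; omega))
    have h' := intCast_mul_completeHomogeneous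
      (A := MvPowerSeries ℕ+ K) MvPowerSeries.X (n - i) (N + i) (by push_cast; omega)
    rw [Derivation.leibniz, Derivation.map_intCast, smul_zero, add_zero, smul_eq_mul] at h
    rw [h, map_sum]
    -- Differentiating the explicit t_i gives i h_{n-i}; the other pieces form the recursion for
    -- (n-i) h_{n-i}. Together they give n h_{n-i}.
    have hterm : ∀ a ∈ Finset.range (N + i), MvPowerSeries.pderiv K i
        (((a + 1 : ℕ) : MvPowerSeries ℕ+ K) * MvPowerSeries.X a.succPNat *
          completeHomogeneous MvPowerSeries.X (n - 1 - a)) =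
        (if a = i.natPred then ((i : ℕ) : MvPowerSeries ℕ+ K) *
          completeHomogeneous MvPowerSeries.X (n - i) else 0) +
        ((a + 1 : ℕ) : MvPowerSeries ℕ+ K) * MvPowerSeries.X a.succPNat *
          completeHomogeneous MvPowerSeries.X (n - i - 1 - a) := by
      intro a _
      rw [Derivation.leibniz, Derivation.leibniz, Derivation.map_natCast, smul_zero, add_zero]
      have hI : MvPowerSeries.pderiv K i
          (completeHomogeneous (A := MvPowerSeries ℕ+ K) MvPowerSeries.X (n - 1 - a)) =
          completeHomogeneous MvPowerSeries.X (n - i - 1 - a) := by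
        rw [ih (N - 1) (by omega) _ (by omega)]
        congr 1
        ring
      rw [hI, smul_eq_mul, smul_eq_mul, smul_eq_mul, add_comm]
      congr 1
      by_cases hai : a = i.natPred
      · subst hai
        rw [if_pos rfl, PNat.succPNat_natPred, MvPowerSeries.pderiv_X_self, mul_one, mul_comm,
          PNat.natPred_add_one]
        congr 2
        have := PNat.natPred_add_one i
        omega
      · rw [if_neg hai, MvPowerSeries.pderiv_X_of_ne, mul_zero, mul_zero]
        rintro rfl
        exact hai (Nat.natPred_succPNat a).symm
    rw [Finset.sum_congr rfl hterm, Finset.sum_add_distrib, ← h', Finset.sum_ite_eq',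
      if_pos (Finset.mem_range.2 (by have := PNat.natPred_add_one i; omega))]
    push_cast
    ring

/-- `det (h_{s_i + j})`. -/
noncomputable def shiftedDet {A : Type*} [CommRing A] [Algebra ℂ A] (t : ℕ+ → A) {n : ℕ}
    (s : Fin n → ℤ) : A :=
  (Matrix.of fun i j : Fin n => completeHomogeneous t (s i + (j : ℕ))).det

/-- The derivation acts row by row, and in row k it lowers every index by i. This is the rule that
`alpha_wedgeVec` gives for α_i. -/
theorem pderiv_shiftedDet (i : ℕ+) {n : ℕ} (s : Fin n → ℤ) :
    MvPowerSeries.pderiv K i (shiftedDet (A := MvPowerSeries ℕ+ K) MvPowerSeries.X s) =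
      ∑ k, shiftedDet MvPowerSeries.X (Function.update s k (s k - i)) := by
  rw [shiftedDet, Derivation.map_det]
  refine Finset.sum_congr rfl fun k _ => ?_
  rw [shiftedDet]
  congr 1
  ext1 a b
  by_cases h : a = k
  · subst h
    rw [Matrix.updateRow_self, Matrix.of_apply, Matrix.of_apply, Function.update_self,
      pderiv_completeHomogeneous]
    congr 1
    ring
  · rw [Matrix.updateRow_ne h, Matrix.of_apply, Matrix.of_apply, Function.update_of_ne h]

theorem constantCoeff_completeHomogeneous (n : ℤ) :
    MvPowerSeries.constantCoeff
      (completeHomogeneous (A := MvPowerSeries ℕ+ K) MvPowerSeries.X n) =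
      if n = 0 then 1 else 0 := by
  split_ifs with h
  · rw [h, completeHomogeneous_zero, map_one]
  · have hr := congrArg MvPowerSeries.constantCoeff (intCast_mul_completeHomogeneous
      (A := MvPowerSeries ℕ+ K) MvPowerSeries.X n n.toNat (by omega))
    refine intCast_mul_cancel h ?_
    rw [map_mul, map_intCast] at hr
    rw [hr, map_sum, mul_zero]
    exact Finset.sum_eq_zero fun a _ => by simp

end CompleteHomogeneous

/-! ### Fermions on the semi-infinite wedge space and the exponential of the currents -/

section Fermions

namespace Maya

@[ext]
theorem ext {S T : Maya} (h : S.1 = T.1) : S = T := Subtype.ext h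

theorem finite_above (i : ℤ) (S : Maya) : {j ∈ S.1 | i < j}.Finite := by
  refine (S.2.1.union (Set.finite_Ioc i 0)).subset ?_
  rintro j ⟨hj, hij⟩
  rcases le_or_gt j 0 with h | h
  · exact Or.inr ⟨hij, h⟩
  · exact Or.inl ⟨hj, h⟩

theorem mem_insert {i j : ℤ} {S : Maya} : j ∈ (S.insert i).1 ↔ j = i ∨ j ∈ S.1 := Iff.rfl

theorem mem_erase {i j : ℤ} {S : Maya} : j ∈ (S.erase i).1 ↔ j ∈ S.1 ∧ j ≠ i := Iff.rfl

theorem above_insert (i j : ℤ) {S : Maya} (hj : j ∉ S.1) :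
    (S.insert j).above i = S.above i + if i < j then 1 else 0 := by
  unfold above
  split_ifs with h
  · rw [← Set.ncard_insert_of_notMem (fun h' => hj h'.1) (finite_above i S)]
    congr 1
    ext x
    simp only [mem_insert, Set.mem_ofPred_eq, Set.mem_insert_iff]
    constructor
    · rintro ⟨rfl | hx, hx'⟩
      · exact Or.inl rfl
      · exact Or.inr ⟨hx, hx'⟩
    · rintro (rfl | ⟨hx, hx'⟩)
      · exact ⟨Or.inl rfl, h⟩
      · exact ⟨Or.inr hx, hx'⟩
  · rw [add_zero]
    congr 1
    ext x
    simp only [mem_insert, Set.mem_ofPred_eq]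
    constructor
    · rintro ⟨rfl | hx, hx'⟩
      · exact absurd hx' h
      · exact ⟨hx, hx'⟩
    · rintro ⟨hx, hx'⟩
      exact ⟨Or.inr hx, hx'⟩

theorem insert_erase {i : ℤ} {S : Maya} (hi : i ∈ S.1) : (S.erase i).insert i = S := by
  ext x
  simp only [mem_insert, mem_erase]
  by_cases h : x = i
  · simp [h, hi]
  · simp [h]

theorem erase_insert {i : ℤ} {S : Maya} (hi : i ∉ S.1) : (S.insert i).erase i = S := by
  ext x
  simp only [mem_insert, mem_erase]
  by_cases h : x = i
  · simp [h, hi]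
  · simp [h]

theorem above_erase (i j : ℤ) {S : Maya} (hj : j ∈ S.1) :
    S.above i = (S.erase j).above i + if i < j then 1 else 0 := by
  rw [← above_insert i j (fun h => (mem_erase.1 h).2 rfl), insert_erase hj]

theorem insert_comm (i j : ℤ) (S : Maya) : (S.insert i).insert j = (S.insert j).insert i :=
  ext (Set.insert_comm j i S.1)

theorem erase_insert_comm {i j : ℤ} (h : i ≠ j) (S : Maya) :
    (S.insert i).erase j = (S.erase j).insert i := by
  ext x
  simp only [mem_insert, mem_erase]
  constructor
  · rintro ⟨rfl | hx, hx'⟩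
    · exact Or.inl rfl
    · exact Or.inr ⟨hx, hx'⟩
  · rintro (rfl | ⟨hx, hx'⟩)
    · exact ⟨Or.inl rfl, h⟩
    · exact ⟨Or.inr hx, hx'⟩

/-- The vacuum `z^c ∧ z^{c-1} ∧ ⋯`. -/
def vac (c : ℤ) : Maya :=
  ⟨Set.Iic c, (Set.finite_Ioc 0 c).subset fun _ hx => ⟨hx.2, hx.1⟩,
    (Set.finite_Ioc c 0).subset fun _ hx => ⟨not_le.1 hx.2, hx.1⟩⟩

theorem mem_vac {c j : ℤ} : j ∈ (vac c).1 ↔ j ≤ c := Iff.rfl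

theorem above_eq_zero {i : ℤ} {S : Maya} (h : ∀ j ∈ S.1, j ≤ i) : S.above i = 0 := by
  unfold above
  rw [Set.ncard_eq_zero (finite_above i S)]
  exact Set.eq_empty_of_forall_notMem fun j hj => absurd (h j hj.1) (not_le.2 hj.2)

theorem ofDiagram_bot : ofDiagram ⊥ = vac 0 := by
  ext x
  change (∃ i : ℕ, ((⊥ : YoungDiagram).rowLen i : ℤ) - i = x) ↔ x ≤ 0
  have h : ∀ i, (⊥ : YoungDiagram).rowLen i = 0 := by
    intro i
    by_contra hne
    exact YoungDiagram.notMem_bot _ (YoungDiagram.mem_iff_lt_rowLen.2 (Nat.pos_of_ne_zero hne))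
  constructor
  · rintro ⟨i, rfl⟩
    simp [h]
  · intro hx
    exact ⟨(-x).toNat, by rw [h]; omega⟩

end Maya

open Maya

variable (K : Type*) [Field K]

theorem psi_single_of_mem {i : ℤ} {S : Maya} (h : i ∈ S.1) (a : K) :
    psi K i (Finsupp.single S a) = 0 := by
  rw [psi, Finsupp.linearCombination_single, if_pos h, smul_zero]

theorem psi_single_of_notMem {i : ℤ} {S : Maya} (h : i ∉ S.1) (a : K) :
    psi K i (Finsupp.single S a) = Finsupp.single (S.insert i) (a * (-1) ^ S.above i) := by
  rw [psi, Finsupp.linearCombination_single, if_neg h, Finsupp.smul_single, smul_eq_mul]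

theorem psiStar_single_of_notMem {i : ℤ} {S : Maya} (h : i ∉ S.1) (a : K) :
    psiStar K i (Finsupp.single S a) = 0 := by
  rw [psiStar, Finsupp.linearCombination_single, if_neg h, smul_zero]

theorem psiStar_single_of_mem {i : ℤ} {S : Maya} (h : i ∈ S.1) (a : K) :
    psiStar K i (Finsupp.single S a) = Finsupp.single (S.erase i) (a * (-1) ^ S.above i) := by
  rw [psiStar, Finsupp.linearCombination_single, if_pos h, Finsupp.smul_single, smul_eq_mul]

theorem psi_psi (i j : ℤ) (v : Wedge K) : psi K i (psi K j v) = -psi K j (psi K i v) := by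
  induction v using Finsupp.induction_linear with
  | zero => simp
  | add f g hf hg => simp only [map_add, hf, hg, neg_add]
  | single S a =>
    by_cases hi : i ∈ S.1
    · rw [psi_single_of_mem K hi, map_zero, neg_zero]
      by_cases hj : j ∈ S.1
      · rw [psi_single_of_mem K hj, map_zero]
      · rw [psi_single_of_notMem K hj, psi_single_of_mem K (mem_insert.2 (Or.inr hi))]
    rw [psi_single_of_notMem K hi]
    by_cases hj : j ∈ S.1
    · rw [psi_single_of_mem K hj, psi_single_of_mem K (mem_insert.2 (Or.inr hj)), map_zero,
        neg_zero]
    rw [psi_single_of_notMem K hj]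
    by_cases hij : i = j
    · subst hij
      rw [psi_single_of_mem K (mem_insert.2 (Or.inl rfl)), neg_zero]
    rw [psi_single_of_notMem K (by rw [mem_insert]; tauto),
      psi_single_of_notMem K (by rw [mem_insert, eq_comm]; tauto), insert_comm, ← Finsupp.single_neg,
      above_insert i j hj, above_insert j i hi]
    congr 1
    rcases lt_or_gt_of_ne hij with h | h
    · rw [if_pos h, if_neg h.not_gt]; ring
    · rw [if_neg h.not_gt, if_pos h]; ring

/-- The canonical anticommutation relation. For i ≠ j the two orders differ in sign because the
smaller exponent sees the larger one to its left in just one of them. -/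
theorem psiStar_psi (i j : ℤ) (v : Wedge K) :
    psiStar K i (psi K j v) = (if i = j then v else 0) - psi K j (psiStar K i v) := by
  induction v using Finsupp.induction_linear with
  | zero => simp
  | add f g hf hg =>
    simp only [map_add, hf, hg]
    split_ifs <;> abel
  | single S a =>
    by_cases hij : i = j
    · subst hij
      rw [if_pos rfl]
      by_cases hi : i ∈ S.1
      · rw [psi_single_of_mem K hi, map_zero, psiStar_single_of_mem K hi,
          psi_single_of_notMem K (fun h => (mem_erase.1 h).2 rfl), insert_erase hi,
          above_erase i i hi, if_neg (lt_irrefl i), add_zero, mul_assoc, ← mul_pow]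
        simp
      · rw [psi_single_of_notMem K hi, psiStar_single_of_mem K (mem_insert.2 (Or.inl rfl)),
          psiStar_single_of_notMem K hi, map_zero, sub_zero, erase_insert hi,
          above_insert i i hi, if_neg (lt_irrefl i), add_zero, mul_assoc, ← mul_pow]
        simp
    rw [if_neg hij, zero_sub]
    by_cases hi : i ∈ S.1
    · rw [psiStar_single_of_mem K hi]
      by_cases hj : j ∈ S.1
      · rw [psi_single_of_mem K hj, psi_single_of_mem K (mem_erase.2 ⟨hj, Ne.symm hij⟩), map_zero,
          neg_zero]
      rw [psi_single_of_notMem K hj, psi_single_of_notMem K (fun h => hj (mem_erase.1 h).1),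
        psiStar_single_of_mem K (mem_insert.2 (Or.inr hi)), erase_insert_comm (Ne.symm hij),
        ← Finsupp.single_neg, above_insert i j hj, above_erase j i hi]
      congr 1
      rcases lt_or_gt_of_ne hij with h | h
      · rw [if_pos h, if_neg h.not_gt]; ring
      · rw [if_neg h.not_gt, if_pos h]; ring
    · rw [psiStar_single_of_notMem K hi, map_zero, neg_zero]
      by_cases hj : j ∈ S.1
      · rw [psi_single_of_mem K hj, map_zero]
      · rw [psi_single_of_notMem K hj, psiStar_single_of_notMem K (by rw [mem_insert]; tauto)]

theorem psi_psiStar_single_eq_zero (n : ℕ+) {i : ℤ} {S : Maya} (h : i ∈ S.1 → i - n ∈ S.1) (a : K) :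
    psi K (i - n) (psiStar K i (Finsupp.single S a)) = 0 := by
  have hn := n.pos
  by_cases hi : i ∈ S.1
  · rw [psiStar_single_of_mem K hi, psi_single_of_mem K (mem_erase.2 ⟨h hi, by omega⟩)]
  · rw [psiStar_single_of_notMem K hi, map_zero]

theorem finite_support_psi_psiStar (n : ℕ+) (v : Wedge K) :
    (Function.support fun i : ℤ => psi K (i - n) (psiStar K i v)).Finite := by
  induction v using Finsupp.induction_linear with
  | zero => simp
  | add f g hf hg =>
    refine (hf.union hg).subset fun i hi => ?_
    by_contra h
    simp only [Set.mem_union, Function.mem_support, not_or, not_not] at h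
    exact hi (by beta_reduce; rw [map_add, map_add, h.1, h.2, add_zero])
  | single S a =>
    refine (S.2.1.union (S.2.2.image fun j => j + (n : ℤ))).subset fun i hi => ?_
    have hn := n.pos
    have h : i ∈ S.1 ∧ i - n ∉ S.1 := by
      by_contra h
      exact hi (psi_psiStar_single_eq_zero K n (by tauto) a)
    rcases le_or_gt i 0 with h0 | h0
    · exact Or.inr ⟨i - n, ⟨by simp only [Set.mem_Iic]; omega, h.2⟩, by ring⟩
    · exact Or.inl ⟨h.1, h0⟩

theorem alpha_apply (n : ℕ+) (v : Wedge K) :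
    alpha K n v = ∑ᶠ i : ℤ, psi K (i - n) (psiStar K i v) := by
  induction v using Finsupp.induction_linear with
  | zero => simp
  | add f g hf hg =>
    simp only [map_add]
    rw [hf, hg, finsum_add_distrib (finite_support_psi_psiStar K n f)
      (finite_support_psi_psiStar K n g)]
  | single S a =>
    rw [alpha, Finsupp.linearCombination_single, smul_finsum]
    refine finsum_congr fun i => ?_
    rw [← map_smul, ← map_smul, Finsupp.smul_single, smul_eq_mul, mul_one]

/-- The commutator [α_n, ψ_s] = ψ_{s-n}: moving ψ_s to the left past ψ_{i-n} ψ_i^* costs two signs,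
and the anticommutator contributes only at i = s. -/
theorem alpha_psi (n : ℕ+) (s : ℤ) (v : Wedge K) :
    alpha K n (psi K s v) = psi K (s - n) v + psi K s (alpha K n v) := by
  have h : ∀ i : ℤ, psi K (i - n) (psiStar K i (psi K s v)) =
      (if i = s then psi K (s - n) v else 0) + psi K s (psi K (i - n) (psiStar K i v)) := by
    intro i
    rw [psiStar_psi, map_sub, psi_psi K (i - n) s, sub_neg_eq_add]
    congr 1
    split_ifs with h
    · rw [h]
    · rw [map_zero]
  have hfin : (Function.support fun i : ℤ => if i = s then psi K (s - n) v else 0).Finite :=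
    (Set.finite_singleton s).subset fun i hi => by
      by_contra h
      exact hi (if_neg h)
  have hfin' : (Function.support fun i : ℤ => psi K s (psi K (i - n) (psiStar K i v))).Finite :=
    (finite_support_psi_psiStar K n v).subset fun i hi h => hi (by
      beta_reduce at h ⊢
      rw [h, map_zero])
  rw [alpha_apply, finsum_congr h, finsum_add_distrib hfin hfin',
    finsum_eq_single _ s fun i hi => if_neg hi, if_pos rfl, alpha_apply]
  congr 1
  exact ((psi K s).toAddMonoidHom.map_finsum (finite_support_psi_psiStar K n v)).symm

theorem alpha_vac (n : ℕ+) (c : ℤ) : alpha K n (Finsupp.single (vac c) 1) = 0 := by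
  rw [alpha_apply]
  refine finsum_eq_zero_of_forall_eq_zero fun i => psi_psiStar_single_eq_zero K n (fun h => ?_) 1
  rw [mem_vac] at h ⊢
  have := n.pos
  omega

/-- No sign appears because z^c is the first factor of the vacuum. This lets a vacuum coefficient be
computed by contracting one exponent at a time. -/
theorem psiStar_apply_vac (c : ℤ) (v : Wedge K) : psiStar K c v (vac (c - 1)) = v (vac c) := by
  classical
  induction v using Finsupp.induction_linear with
  | zero => simp
  | add f g hf hg => rw [map_add, Finsupp.add_apply, Finsupp.add_apply, hf, hg]
  | single S a =>
    have h' : c ∉ (vac (c - 1)).1 := by rw [mem_vac]; omega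
    have h'' : (vac (c - 1)).insert c = vac c := by
      ext x
      simp only [mem_insert, mem_vac]
      omega
    by_cases hc : c ∈ S.1
    · rw [psiStar_single_of_mem K hc]
      by_cases hS : S = vac c
      · subst hS
        rw [← h'', erase_insert h', Finsupp.single_eq_same, Finsupp.single_eq_same, h'',
          above_eq_zero fun j hj => hj, pow_zero, mul_one]
      · rw [Finsupp.single_eq_of_ne (Ne.symm hS), Finsupp.single_eq_of_ne]
        intro h
        rw [h, insert_erase hc] at h''
        exact hS h''
    · rw [psiStar_single_of_notMem K hc, Finsupp.single_eq_of_ne]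
      · rfl
      · rintro rfl
        exact hc (mem_vac.2 le_rfl)

/-- `ψ_{s_0} ψ_{s_1} ⋯ ψ_{s_{n-1}} (z^M ∧ z^{M-1} ∧ ⋯)`. -/
noncomputable def wedgeVec (M : ℤ) : (n : ℕ) → (Fin n → ℤ) → Wedge K
  | 0, _ => Finsupp.single (vac M) 1
  | n + 1, s => psi K (s 0) (wedgeVec M n (Fin.tail s))

theorem wedgeVec_succ (M : ℤ) {n : ℕ} (s : Fin (n + 1) → ℤ) :
    wedgeVec K M (n + 1) s = psi K (s 0) (wedgeVec K M n (Fin.tail s)) := rfl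

/-- Commute α_i through the ψ's with `alpha_psi`; the vacuum at the end is annihilated. -/
theorem alpha_wedgeVec (i : ℕ+) (M : ℤ) {n : ℕ} (s : Fin n → ℤ) :
    alpha K i (wedgeVec K M n s) =
      ∑ k, wedgeVec K M n (Function.update s k (s k - i)) := by
  induction n with
  | zero => simp [wedgeVec, alpha_vac]
  | succ n ih =>
    rw [wedgeVec_succ, alpha_psi, ih, Fin.sum_univ_succ, map_sum, wedgeVec_succ,
      Function.update_self, Fin.tail_update_zero]
    congr 1
    refine Finset.sum_congr rfl fun k _ => ?_
    rw [wedgeVec_succ, Fin.tail_update_succ, Function.update_of_ne (Fin.succ_ne_zero k).symm]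
    rfl

theorem psiStar_wedgeVec {c M : ℤ} (hc : M < c) {n : ℕ} (s : Fin (n + 1) → ℤ) :
    psiStar K c (wedgeVec K M (n + 1) s) =
      ∑ k : Fin (n + 1), ((-1) ^ (k : ℕ) * (if s k = c then 1 else 0) : K) •
        wedgeVec K M n (s ∘ k.succAbove) := by
  have hvac : psiStar K c (Finsupp.single (vac M) 1) = 0 :=
    psiStar_single_of_notMem K (by rw [mem_vac]; omega) 1
  induction n with
  | zero =>
    simp only [wedgeVec, psiStar_psi, hvac]
    simp [eq_comm]
  | succ n ih =>
    rw [wedgeVec_succ, psiStar_psi, ih, Fin.sum_univ_succ (n := n + 1), map_sum, sub_eq_add_neg,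
      ← Finset.sum_neg_distrib]
    congr 1
    · simp only [Fin.val_zero, pow_zero, one_mul, ite_smul, one_smul, zero_smul, eq_comm (a := c)]
      rfl
    · refine Finset.sum_congr rfl fun k _ => ?_
      rw [map_smul, ← neg_smul, Fin.val_succ, pow_succ, wedgeVec_succ]
      congr 1
      · rw [show Fin.tail s k = s k.succ from rfl]
        ring
      · congr 2
        ext a
        simp [Fin.tail]

/-- Contracting with the top exponent of the vacuum is Laplace expansion along the first column. The
exponents need not be decreasing or distinct, which the repeated lowering by α_i requires. -/
theorem wedgeVec_apply_vac (M : ℤ) {n : ℕ} (s : Fin n → ℤ) :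
    wedgeVec K M n s (vac (M + n)) =
      (Matrix.of fun i j : Fin n => if s i = M + n - (j : ℕ) then (1 : K) else 0).det := by
  induction n with
  | zero => simp [wedgeVec]
  | succ n ih =>
    rw [← psiStar_apply_vac, psiStar_wedgeVec K (by omega), Matrix.det_succ_column_zero,
      Finsupp.finsetSum_apply]
    refine Finset.sum_congr rfl fun k _ => ?_
    rw [Finsupp.smul_apply, show M + ((n + 1 : ℕ) : ℤ) - 1 = M + n by push_cast; ring, ih,
      smul_eq_mul]
    congr 1
    · simp
    · congr 1
      ext i j
      simp only [Matrix.of_apply, Matrix.submatrix_apply, Function.comp_apply, Fin.val_succ]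
      congr 2
      push_cast
      ring

/-- Each ψ adds an exponent larger than all those present, so every sign is trivial. -/
theorem wedgeVec_of_strictAnti {M : ℤ} {n : ℕ} {s : Fin n → ℤ} (hs : StrictAnti s)
    (hM : ∀ i, M < s i) {S : Maya} (hS : S.1 = Set.range s ∪ Set.Iic M) :
    wedgeVec K M n s = Finsupp.single S 1 := by
  induction n generalizing S with
  | zero =>
    rw [wedgeVec]
    congr 1
    ext x
    simp [hS, mem_vac]
  | succ n ih =>
    have hlt : ∀ i, Fin.tail s i < s 0 := fun i => hs (Fin.succ_pos i)
    have h0 : s 0 ∈ S.1 := hS ▸ Or.inl ⟨0, rfl⟩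
    have hmem : s 0 ∉ (S.erase (s 0)).1 := fun h => (mem_erase.1 h).2 rfl
    rw [wedgeVec_succ, ih (s := Fin.tail s) (S := S.erase (s 0))
      (fun i j hij => hs (Fin.succ_lt_succ_iff.2 hij))
      (fun i => hM _), psi_single_of_notMem K hmem, insert_erase h0, above_eq_zero, pow_zero,
      mul_one]
    · intro j hj
      obtain ⟨hj, -⟩ := mem_erase.1 hj
      rw [hS] at hj
      rcases hj with ⟨i, rfl⟩ | hj
      · exact hs.antitone (Fin.zero_le i)
      · exact hj.trans (hM 0).le
    · ext x
      rw [mem_erase, hS]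
      constructor
      · rintro ⟨⟨i, rfl⟩ | hx, hx'⟩
        · refine Or.inl ?_
          obtain rfl | ⟨k, rfl⟩ := Fin.eq_zero_or_eq_succ i
          · exact absurd rfl hx'
          · exact ⟨k, rfl⟩
        · exact Or.inr hx
      · rintro (⟨i, rfl⟩ | hx)
        · exact ⟨Or.inl ⟨i.succ, rfl⟩, (hlt i).ne⟩
        · exact ⟨Or.inr hx, (hx.trans_lt (hM 0)).ne⟩

theorem YoungDiagram.rowLen_eq_zero {lam : YoungDiagram} {i : ℕ} (h : lam.colLen 0 ≤ i) :
    lam.rowLen i = 0 := by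
  by_contra hne
  have h1 : (i, 0) ∈ lam := YoungDiagram.mem_iff_lt_rowLen.2 (Nat.pos_of_ne_zero hne)
  exact absurd (YoungDiagram.mem_iff_lt_colLen.1 h1) (not_lt.2 h)

theorem wedgeVec_ofDiagram (lam : YoungDiagram) {n : ℕ} (hn : lam.colLen 0 ≤ n) :
    wedgeVec K (-n) n (fun i => (lam.rowLen i : ℤ) - (i : ℕ)) =
      Finsupp.single (ofDiagram lam) 1 := by
  refine wedgeVec_of_strictAnti K ?_ ?_ ?_
  · intro i j hij
    have h1 := lam.rowLen_anti i j hij.le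
    have h2 : (i : ℕ) < j := hij
    beta_reduce
    omega
  · intro i
    have := i.2
    omega
  · ext x
    change (∃ i : ℕ, (lam.rowLen i : ℤ) - i = x) ↔ _
    constructor
    · rintro ⟨i, rfl⟩
      rcases lt_or_ge i n with h | h
      · exact Or.inl ⟨⟨i, h⟩, rfl⟩
      · refine Or.inr ?_
        rw [YoungDiagram.rowLen_eq_zero (hn.trans h), Set.mem_Iic]
        omega
    · rintro (⟨i, rfl⟩ | hx)
      · exact ⟨i, rfl⟩
      · rw [Set.mem_Iic] at hx
        refine ⟨(-x).toNat, ?_⟩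
        rw [YoungDiagram.rowLen_eq_zero (by omega)]
        omega

theorem degree_tsub_single {σ : Type*} {m : σ →₀ ℕ} {i : σ} (hi : i ∈ m.support) :
    (m - Finsupp.single i 1).degree + 1 = m.degree := by
  have h : (m - Finsupp.single i 1).degree + (Finsupp.single i 1).degree = m.degree := by
    rw [← map_add, tsub_add_cancel_of_le
      (Finsupp.single_le_iff.2 (Nat.one_le_iff_ne_zero.2 (Finsupp.mem_support_iff.1 hi)))]
  rwa [Finsupp.degree_single] at h

theorem coeff_single_alphaSeries (i : ℕ+) :
    MvPowerSeries.coeff (Finsupp.single i 1) (alphaSeries K) = alpha K i := by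
  change ∑ j ∈ (Finsupp.single i 1).support, _ = _
  rw [Finsupp.support_single i one_ne_zero, Finset.sum_singleton, if_pos rfl]

theorem coeff_alphaSeries_eq_zero {m : ℕ+ →₀ ℕ} (h : ∀ i, m ≠ Finsupp.single i 1) :
    MvPowerSeries.coeff m (alphaSeries K) = 0 :=
  Finset.sum_eq_zero fun i _ => if_neg (h i)

theorem coeff_mul_alphaSeries (f : MvPowerSeries ℕ+ (Module.End K (Wedge K))) (m : ℕ+ →₀ ℕ) :
    MvPowerSeries.coeff m (f * alphaSeries K) =
      ∑ i ∈ m.support, MvPowerSeries.coeff (m - Finsupp.single i 1) f * alpha K i := by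
  classical
  rw [MvPowerSeries.coeff_mul]
  symm
  refine Finset.sum_of_injOn (fun i => (m - Finsupp.single i 1, Finsupp.single i 1)) ?_ ?_ ?_ ?_
  · intro i _ j _ h
    exact (Finsupp.single_left_inj one_ne_zero).1 (Prod.ext_iff.1 h).2
  · intro i hi
    rw [Finset.mem_coe, Finset.HasAntidiagonal.mem_antidiagonal]
    exact tsub_add_cancel_of_le
      (Finsupp.single_le_iff.2 (Nat.one_le_iff_ne_zero.2 (Finsupp.mem_support_iff.1 hi)))
  · rintro ⟨p, q⟩ hpq hne
    rw [Finset.HasAntidiagonal.mem_antidiagonal] at hpq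
    rw [coeff_alphaSeries_eq_zero, mul_zero]
    rintro i rfl
    refine hne ⟨i, ?_, Prod.ext ?_ rfl⟩
    · rw [Finset.mem_coe, Finsupp.mem_support_iff, ← hpq]
      simp
    · simp [← hpq]
  · intro i _
    rw [coeff_single_alphaSeries]

theorem coeff_zero_expAlpha : MvPowerSeries.coeff 0 (expAlpha K) = 1 := by
  have h : MvPowerSeries.coeff 0 (expAlpha K) = ((0 : ℕ+ →₀ ℕ).degree.factorial : K)⁻¹ •
    MvPowerSeries.coeff 0 (alphaSeries K ^ (0 : ℕ+ →₀ ℕ).degree) := rfl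
  rw [h, map_zero, pow_zero, Nat.factorial_zero, Nat.cast_one, inv_one, one_smul,
    MvPowerSeries.coeff_zero_one]

/-- Euler's identity for exp A with A linear in the times: r A^r / r! = (A^{r-1} / (r-1)!) A.
Splitting off the right-hand factor avoids any appeal to commutativity of the α_i. -/
theorem degree_smul_coeff_expAlpha [CharZero K] (m : ℕ+ →₀ ℕ) :
    (m.degree : K) • MvPowerSeries.coeff m (expAlpha K) =
      ∑ i ∈ m.support, MvPowerSeries.coeff (m - Finsupp.single i 1) (expAlpha K) * alpha K i := by
  have hE : ∀ m, MvPowerSeries.coeff m (expAlpha K) =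
    (m.degree.factorial : K)⁻¹ • MvPowerSeries.coeff m (alphaSeries K ^ m.degree) := fun _ => rfl
  rcases h : m.degree with _ | r
  · rw [Finset.sum_eq_zero]
    · simp
    · intro i hi
      have := degree_tsub_single hi
      omega
  · rw [hE, h, pow_succ, coeff_mul_alphaSeries, smul_smul, Nat.factorial_succ, Nat.cast_mul,
      mul_inv, mul_inv_cancel_left₀ (Nat.cast_ne_zero.2 r.succ_ne_zero), Finset.smul_sum]
    refine Finset.sum_congr rfl fun i hi => ?_
    have h' := degree_tsub_single hi
    have h'' : (m - Finsupp.single i 1).degree = r := by omega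
    rw [hE, h'', smul_mul_assoc]

end Fermions

/-! ### The boson-fermion correspondence -/

section BosonFermion

open Maya

variable {K : Type*} [Field K] [Algebra ℂ K]

theorem coeff_expAlpha_wedgeVec (m : ℕ+ →₀ ℕ) {n : ℕ} (s : Fin n → ℤ) :
    MvPowerSeries.coeff m (expAlpha K) (wedgeVec K (-n) n s) (vac 0) =
      MvPowerSeries.coeff m (shiftedDet (A := MvPowerSeries ℕ+ K) MvPowerSeries.X s) := by
  have : CharZero K := charZero_of_injective_algebraMap (algebraMap ℂ K).injective
  induction hr : m.degree generalizing m s with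
  | zero =>
    obtain rfl : m = 0 := (Finsupp.degree_eq_zero_iff m).1 hr
    rw [coeff_zero_expAlpha, Module.End.one_apply, MvPowerSeries.coeff_zero_eq_constantCoeff_apply,
      shiftedDet, RingHom.map_det]
    have h := wedgeVec_apply_vac K (-n) s
    rw [neg_add_cancel] at h
    rw [h]
    congr 1
    ext i j
    simp only [Matrix.of_apply, RingHom.mapMatrix_apply, Matrix.map_apply,
      constantCoeff_completeHomogeneous, zero_sub, eq_neg_iff_add_eq_zero]
  | succ r ih =>
    have hr0 : (m.degree : K) ≠ 0 := by rw [hr]; exact Nat.cast_ne_zero.2 r.succ_ne_zero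
    refine mul_left_cancel₀ hr0 ?_
    rw [← smul_eq_mul, ← Finsupp.smul_apply, ← LinearMap.smul_apply, degree_smul_coeff_expAlpha,
      LinearMap.sum_apply, Finsupp.finsetSum_apply, Finsupp.degree_apply, Nat.cast_sum,
      Finset.sum_mul]
    refine Finset.sum_congr rfl fun i hi => ?_
    have hle : Finsupp.single i 1 ≤ m :=
      Finsupp.single_le_iff.2 (Nat.one_le_iff_ne_zero.2 (Finsupp.mem_support_iff.1 hi))
    have hdeg : (m - Finsupp.single i 1).degree = r := by
      have := degree_tsub_single hi
      omega
    -- Both sides have been multiplied by deg m = ∑ m_i. The i-th share m_i of the coefficient at m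
    -- is the coefficient of the i-th derivative at m - e_i, where induction applies.
    have hp := congrArg (MvPowerSeries.coeff (m - Finsupp.single i 1))
      (pderiv_shiftedDet (K := K) i s)
    rw [MvPowerSeries.coeff_pderiv, tsub_add_cancel_of_le hle, map_sum] at hp
    rw [Module.End.mul_apply, alpha_wedgeVec, map_sum, Finsupp.finsetSum_apply,
      Finset.sum_congr rfl fun k _ => ih _ _ hdeg, ← hp, mul_comm]
    congr 1
    rw [← Nat.cast_succ, Nat.succ_eq_add_one]
    congr 1
    have := Finsupp.single_le_iff.1 hle
    simp only [Finsupp.tsub_apply, Finsupp.single_eq_same]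
    omega

/-- The boson-fermion correspondence sends `v_λ` to the Schur function `s_λ`. -/
theorem fermionToBoson_eq_schurFunction (lam : YoungDiagram) :
    fermionToBoson K lam = schurFunction (A := MvPowerSeries ℕ+ K) MvPowerSeries.X lam := by
  ext m
  change MvPowerSeries.coeff m (expAlpha K) (Finsupp.single (Maya.ofDiagram lam) 1)
    (Maya.ofDiagram ⊥) = _
  rw [ofDiagram_bot, ← wedgeVec_ofDiagram K lam le_rfl, coeff_expAlpha_wedgeVec]
  rfl

end BosonFermion

/-! ### Homogeneity and linear independence of Schur functions; injectivity of bosonization -/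

section SchurFunctions

theorem Matrix.det_of_last_row {R : Type*} [CommRing R] {n : ℕ}
    (A : Matrix (Fin (n + 1)) (Fin (n + 1)) R) (h0 : ∀ j : Fin n, A (Fin.last n) j.castSucc = 0)
    (h1 : A (Fin.last n) (Fin.last n) = 1) :
    A.det = (A.submatrix Fin.castSucc Fin.castSucc).det := by
  rw [Matrix.det_succ_row A (Fin.last n), Fin.sum_univ_castSucc,
    Finset.sum_eq_zero fun j _ => by rw [h0, mul_zero, zero_mul], zero_add, h1, mul_one,
    Fin.succAbove_last, Even.neg_one_pow ⟨_, rfl⟩, one_mul]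

/-- An empty row contributes (0, …, 0, 1), since h_n = 0 for n < 0, so enlarging the matrix leaves
the determinant unchanged. -/
theorem shiftedDet_ofDiagram {A : Type*} [CommRing A] [Algebra ℂ A] (t : ℕ+ → A)
    (lam : YoungDiagram) {n : ℕ} (hn : lam.colLen 0 ≤ n) :
    shiftedDet t (fun i : Fin n => (lam.rowLen i : ℤ) - (i : ℕ)) = schurFunction t lam := by
  induction n, hn using Nat.le_induction with
  | base => rfl
  | succ n hn ih =>
    rw [← ih, shiftedDet, Matrix.det_of_last_row]
    · rfl
    · intro j
      rw [Matrix.of_apply, Fin.val_last, YoungDiagram.rowLen_eq_zero hn,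
        completeHomogeneous_of_neg]
      have := j.2
      simp only [Fin.val_castSucc]
      omega
    · rw [Matrix.of_apply, Fin.val_last, YoungDiagram.rowLen_eq_zero hn]
      simp [completeHomogeneous_zero]

namespace YoungDiagram

theorem sum_rowLen (lam : YoungDiagram) {n : ℕ} (hn : lam.colLen 0 ≤ n) :
    ∑ i : Fin n, lam.rowLen i = lam.card := by
  rw [Fin.sum_univ_eq_sum_range (fun i => lam.rowLen i) n, YoungDiagram.card,
    Finset.card_eq_sum_card_fiberwise (f := Prod.fst) (t := Finset.range n)]
  · exact Finset.sum_congr rfl fun i _ => lam.rowLen_eq_card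
  · rintro ⟨i, j⟩ h
    rw [Finset.mem_coe, YoungDiagram.mem_cells] at h
    have h' : (i, 0) ∈ lam := lam.up_left_mem le_rfl (Nat.zero_le j) h
    rw [Finset.mem_coe, Finset.mem_range]
    exact (YoungDiagram.mem_iff_lt_colLen.1 h').trans_le hn

theorem finite_card_eq (d : ℕ) : {lam : YoungDiagram | lam.card = d}.Finite := by
  refine Set.Finite.of_finite_image (f := YoungDiagram.cells) ?_
    fun _ _ _ _ h => YoungDiagram.ext h
  refine (Finset.range d ×ˢ Finset.range d).powerset.finite_toSet.subset ?_
  rintro _ ⟨lam, rfl, rfl⟩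
  rw [Finset.mem_coe, Finset.mem_powerset]
  rintro ⟨i, j⟩ h
  rw [YoungDiagram.mem_cells] at h
  rw [Finset.mem_product, Finset.mem_range, Finset.mem_range]
  constructor
  · refine (YoungDiagram.mem_iff_lt_colLen.1 h).trans_le ?_
    rw [YoungDiagram.colLen_eq_card]
    exact Finset.card_filter_le _ _
  · refine (YoungDiagram.mem_iff_lt_rowLen.1 h).trans_le ?_
    rw [YoungDiagram.rowLen_eq_card]
    exact Finset.card_filter_le _ _

/-- The number of rows longer than j is the length of column j. -/
theorem ext_of_card_lt_rowLen {lam mu : YoungDiagram} {n : ℕ} (hl : lam.colLen 0 ≤ n)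
    (hm : mu.colLen 0 ≤ n)
    (h : ∀ j, (∑ i : Fin n, if j < lam.rowLen i then 1 else 0) =
      ∑ i : Fin n, if j < mu.rowLen i then 1 else 0) : lam = mu := by
  have key : ∀ (nu : YoungDiagram), nu.colLen 0 ≤ n → ∀ j,
      (∑ i : Fin n, if j < nu.rowLen i then 1 else 0) = nu.colLen j := by
    intro nu hnu j
    rw [Fin.sum_univ_eq_sum_range (fun i => if j < nu.rowLen i then 1 else 0) n,
      ← Finset.card_filter, ← Finset.card_range (nu.colLen j)]
    congr 1
    ext i
    rw [Finset.mem_filter, Finset.mem_range, Finset.mem_range, ← YoungDiagram.mem_iff_lt_rowLen,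
      YoungDiagram.mem_iff_lt_colLen]
    have := nu.colLen_anti 0 j (Nat.zero_le j)
    omega
  refine YoungDiagram.ext (Finset.ext fun ⟨i, j⟩ => ?_)
  rw [YoungDiagram.mem_cells, YoungDiagram.mem_cells, YoungDiagram.mem_iff_lt_colLen,
    YoungDiagram.mem_iff_lt_colLen, ← key lam hl, h, key mu hm]

end YoungDiagram

variable {K : Type*} [Field K] [Algebra ℂ K]

theorem isWeightedHomogeneous_completeHomogeneous (n : ℤ) :
    MvPolynomial.IsWeightedHomogeneous (fun i : ℕ+ => (i : ℕ))
      (completeHomogeneous (A := MvPolynomial ℕ+ K) MvPolynomial.X n) n.toNat := by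
  have : CharZero K := charZero_of_injective_algebraMap (algebraMap ℂ K).injective
  rcases lt_or_ge n 0 with hn | hn
  · rw [completeHomogeneous_of_neg _ hn]
    exact MvPolynomial.isWeightedHomogeneous_zero _ _ _
  lift n to ℕ using hn
  rw [Int.toNat_natCast]
  induction n using Nat.strong_induction_on with
  | _ n ih =>
    rcases Nat.eq_zero_or_pos n with rfl | hn
    · rw [Nat.cast_zero, completeHomogeneous_zero]
      exact MvPolynomial.isWeightedHomogeneous_one _ _
    have h : completeHomogeneous (A := MvPolynomial ℕ+ K) MvPolynomial.X (n : ℤ) =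
        MvPolynomial.C (n : K)⁻¹ * ((((n : ℕ) : ℤ) : MvPolynomial ℕ+ K) *
          completeHomogeneous (A := MvPolynomial ℕ+ K) MvPolynomial.X (n : ℤ)) := by
      rw [← mul_assoc, Int.cast_natCast, ← map_natCast MvPolynomial.C, ← map_mul,
        inv_mul_cancel₀ (Nat.cast_ne_zero.2 hn.ne'), map_one, one_mul]
    rw [h, intCast_mul_completeHomogeneous _ _ n le_rfl]
    refine MvPolynomial.IsWeightedHomogeneous.C_mul
      (MvPolynomial.IsWeightedHomogeneous.sum _ _ _ fun a ha => ?_) _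
    have ha' := Finset.mem_range.1 ha
    rw [show ((n : ℤ) - 1 - a) = ((n - 1 - a : ℕ) : ℤ) by omega, mul_assoc,
      ← map_natCast MvPolynomial.C]
    refine MvPolynomial.IsWeightedHomogeneous.C_mul ?_ _
    have h2 := (MvPolynomial.isWeightedHomogeneous_X K (fun i : ℕ+ => (i : ℕ)) a.succPNat).mul
      (ih (n - 1 - a) (by omega))
    rwa [Nat.succPNat_coe, show a.succ + (n - 1 - a) = n by omega] at h2

/-- `s_λ(t)` is homogeneous of degree `|λ|` if `t_i` has degree `i`. -/
theorem isWeightedHomogeneous_schurFunction (lam : YoungDiagram) :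
    MvPolynomial.IsWeightedHomogeneous (fun i : ℕ+ => (i : ℕ))
      (schurFunction (A := MvPolynomial ℕ+ K) MvPolynomial.X lam) lam.card := by
  rw [schurFunction, Matrix.det_apply']
  refine MvPolynomial.IsWeightedHomogeneous.sum _ _ _ fun σ _ => ?_
  rw [← map_intCast (MvPolynomial.C : K →+* MvPolynomial ℕ+ K)]
  refine MvPolynomial.IsWeightedHomogeneous.C_mul ?_ _
  simp only [Matrix.of_apply]
  by_cases h : ∀ i, 0 ≤ (lam.rowLen (σ i) : ℤ) - (σ i : ℕ) + (i : ℕ)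
  · have h1 := MvPolynomial.IsWeightedHomogeneous.prod Finset.univ _ _ fun i _ =>
      isWeightedHomogeneous_completeHomogeneous (K := K)
        ((lam.rowLen (σ i) : ℤ) - (σ i : ℕ) + (i : ℕ))
    convert h1 using 1
    zify
    rw [Finset.sum_congr rfl fun i _ => Int.toNat_of_nonneg (h i), Finset.sum_add_distrib,
      Finset.sum_sub_distrib, Equiv.sum_comp σ fun i => ((i : ℕ) : ℤ), sub_add_cancel,
      Equiv.sum_comp σ fun i => (lam.rowLen i : ℤ), ← YoungDiagram.sum_rowLen lam le_rfl]
    push_cast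
    rfl
  · push Not at h
    obtain ⟨i, hi⟩ := h
    rw [Finset.prod_eq_zero (Finset.mem_univ i) (completeHomogeneous_of_neg _ hi)]
    exact MvPolynomial.isWeightedHomogeneous_zero _ _ _

theorem coe_schurFunction (lam : YoungDiagram) :
    ((schurFunction (A := MvPolynomial ℕ+ K) MvPolynomial.X lam : MvPolynomial ℕ+ K) :
      MvPowerSeries ℕ+ K) = schurFunction (A := MvPowerSeries ℕ+ K) MvPowerSeries.X lam := by
  have h := map_schurFunction (A := MvPolynomial ℕ+ K) (B := MvPowerSeries ℕ+ K)
    ((MvPolynomial.coeToMvPowerSeries.algHom (R := K) K).restrictScalars ℂ) MvPolynomial.X lam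
  simpa [MvPolynomial.coeToMvPowerSeries.algHom_apply] using h

theorem coeff_schurFunction (lam : YoungDiagram) (m : ℕ+ →₀ ℕ) :
    MvPowerSeries.coeff m (schurFunction (A := MvPowerSeries ℕ+ K) MvPowerSeries.X lam) =
      MvPolynomial.coeff m (schurFunction (A := MvPolynomial ℕ+ K) MvPolynomial.X lam) := by
  rw [← coe_schurFunction, MvPolynomial.coeff_coe]

/-- Expanding the squares leaves ∑ f_i², a cross term that is nonnegative by the rearrangement
inequality, and ∑ (σ(i) - i)². The diagonal term of a Jacobi-Trudi determinant is thus the only one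
with smallest sum of squared indices. -/
theorem perm_eq_one_of_sum_sq_le {n : ℕ} {f : Fin n → ℤ} (hf : Antitone f)
    (σ : Equiv.Perm (Fin n))
    (h : ∑ i, (f (σ i) - (σ i : ℕ) + (i : ℕ)) ^ 2 ≤ ∑ i, f i ^ 2) : σ = 1 := by
  have hanti : Antivary f fun i : Fin n => ((i : ℕ) : ℤ) := by
    intro i j hij
    exact hf (Nat.cast_lt.1 hij).le
  have h1 := hanti.sum_mul_le_sum_comp_perm_mul (σ := σ)
  have h2 := Equiv.sum_comp σ fun i => f i * ((i : ℕ) : ℤ)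
  have h3 := Equiv.sum_comp σ fun i => f i ^ 2
  have h4 : ∑ i, (f (σ i) - (σ i : ℕ) + (i : ℕ)) ^ 2 = ∑ i, f (σ i) ^ 2
      + 2 * (∑ i, f (σ i) * ((i : ℕ) : ℤ) - ∑ i, f (σ i) * ((σ i : ℕ) : ℤ)) +
      ∑ i, (((σ i : ℕ) : ℤ) - (i : ℕ)) ^ 2 := by
    rw [← Finset.sum_sub_distrib, Finset.mul_sum, ← Finset.sum_add_distrib,
      ← Finset.sum_add_distrib]
    exact Finset.sum_congr rfl fun i _ => by ring
  have h5 : ∑ i, (((σ i : ℕ) : ℤ) - (i : ℕ)) ^ 2 ≤ 0 := by linarith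
  have h6 := (Finset.sum_eq_zero_iff_of_nonneg fun i _ => sq_nonneg _).1
    (h5.antisymm (Finset.sum_nonneg fun i _ => sq_nonneg _))
  ext i
  have := pow_eq_zero_iff two_ne_zero |>.1 (h6 i (Finset.mem_univ i))
  rw [Equiv.Perm.one_apply]
  omega

/-- The exponent of the monomial `∏ y_{f i}`, where `y_0 = 1`. -/
noncomputable def partsExponent {n : ℕ} (f : Fin n → ℕ) : ℕ →₀ ℕ :=
  ∑ i, if f i = 0 then 0 else Finsupp.single (f i) 1

theorem linearCombination_partsExponent {n : ℕ} (f : Fin n → ℕ) (g : ℕ → ℕ) (hg : g 0 = 0) :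
    Finsupp.linearCombination ℕ g (partsExponent f) = ∑ i, g (f i) := by
  rw [partsExponent, map_sum]
  refine Finset.sum_congr rfl fun i _ => ?_
  split_ifs with h
  · rw [map_zero, h, hg]
  · rw [Finsupp.linearCombination_single, one_smul]

theorem eq_of_partsExponent_eq {lam mu : YoungDiagram} {n : ℕ} (hl : lam.colLen 0 ≤ n)
    (hm : mu.colLen 0 ≤ n)
    (h : partsExponent (fun i : Fin n => lam.rowLen i) =
      partsExponent (fun i : Fin n => mu.rowLen i)) : lam = mu := by
  refine YoungDiagram.ext_of_card_lt_rowLen hl hm fun j => ?_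
  have h1 := congrArg (Finsupp.linearCombination ℕ fun n => if j < n then 1 else 0) h
  rwa [linearCombination_partsExponent _ _ (by simp),
    linearCombination_partsExponent _ _ (by simp)] at h1

open scoped Classical in
/-- The coefficient of `∏ y_{λ_i}` in `det (y_{μ_i - i + j})` when `∑ λ_i² ≤ ∑ μ_i²`. -/
theorem coeff_partsExponent_schurFunction {t : ℕ+ → MvPolynomial ℕ K}
    (ht : ∀ n : ℕ, completeHomogeneous t n = if n = 0 then 1 else MvPolynomial.X n)
    {lam mu : YoungDiagram} {n : ℕ} (hl : lam.colLen 0 ≤ n) (hm : mu.colLen 0 ≤ n)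
    (h : ∑ i : Fin n, lam.rowLen i ^ 2 ≤ ∑ i : Fin n, mu.rowLen i ^ 2) :
    MvPolynomial.coeff (partsExponent fun i : Fin n => lam.rowLen i) (schurFunction t mu) =
      if lam = mu then 1 else 0 := by
  have hprod : ∀ f : Fin n → ℕ, ∏ i, completeHomogeneous t (f i) =
      MvPolynomial.monomial (partsExponent f) 1 := by
    intro f
    rw [partsExponent, MvPolynomial.monomial_sum_one]
    refine Finset.prod_congr rfl fun i _ => ?_
    rw [ht]
    split_ifs
    · rfl
    · rfl
  rw [← shiftedDet_ofDiagram t mu hm, shiftedDet, Matrix.det_apply', MvPolynomial.coeff_sum]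
  simp only [Matrix.of_apply]
  have hzero : ∀ σ : Equiv.Perm (Fin n), σ ≠ 1 →
      MvPolynomial.coeff (partsExponent fun i : Fin n => lam.rowLen i)
        (((Equiv.Perm.sign σ : ℤ) : MvPolynomial ℕ K) *
          ∏ i, completeHomogeneous t ((mu.rowLen (σ i) : ℤ) - (σ i : ℕ) + (i : ℕ))) = 0 := by
    intro σ hσ
    by_cases hpos : ∀ i, 0 ≤ (mu.rowLen (σ i) : ℤ) - (σ i : ℕ) + (i : ℕ)
    · choose f hf using fun i => Int.eq_ofNat_of_zero_le (hpos i)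
      rw [Finset.prod_congr rfl fun i _ => by rw [hf i], hprod,
        ← map_intCast (MvPolynomial.C : K →+* MvPolynomial ℕ K),
        MvPolynomial.coeff_C_mul, MvPolynomial.coeff_monomial, if_neg, mul_zero]
      intro he
      -- The sum of squared parts can be read off a monomial, so equal monomials put σ under the
      -- rearrangement bound.
      have h1 := congrArg (Finsupp.linearCombination ℕ fun n => n ^ 2) he
      rw [linearCombination_partsExponent _ _ (by simp),
        linearCombination_partsExponent _ _ (by simp)] at h1
      refine hσ (perm_eq_one_of_sum_sq_le (f := fun i : Fin n => (mu.rowLen i : ℤ))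
        (fun i j hij => Nat.cast_le.2 (mu.rowLen_anti i j hij)) σ ?_)
      rw [Finset.sum_congr rfl fun i _ => by rw [hf i]]
      exact_mod_cast h1.trans_le h
    · push Not at hpos
      obtain ⟨i, hi⟩ := hpos
      rw [Finset.prod_eq_zero (Finset.mem_univ i) (completeHomogeneous_of_neg _ hi), mul_zero,
        MvPolynomial.coeff_zero]
  rw [Finset.sum_eq_single 1 (fun σ _ hσ => hzero σ hσ) fun h => absurd (Finset.mem_univ _) h]
  simp only [Equiv.Perm.sign_one, Units.val_one, Int.cast_one, one_mul, Equiv.Perm.one_apply,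
    sub_add_cancel]
  rw [hprod, MvPolynomial.coeff_monomial]
  congr 1
  rw [eq_iff_iff]
  exact ⟨fun he => (eq_of_partsExponent_eq hm hl he).symm, fun he => by rw [he]⟩

theorem aeval_schurFunction {B : Type*} [CommRing B] [Algebra K B] [Algebra ℂ B]
    [IsScalarTower ℂ K B] (t : ℕ+ → B) (lam : YoungDiagram) :
    MvPolynomial.aeval t (schurFunction (A := MvPolynomial ℕ+ K) MvPolynomial.X lam) =
      schurFunction t lam := by
  refine (map_schurFunction ((MvPolynomial.aeval (R := K) t).restrictScalars ℂ)
    MvPolynomial.X lam).trans ?_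
  congr 1
  funext i
  exact MvPolynomial.aeval_X t i

/-- Schur functions are linearly independent. -/
theorem linearIndependent_schurFunction :
    LinearIndependent K fun lam : YoungDiagram =>
      schurFunction (A := MvPolynomial ℕ+ K) MvPolynomial.X lam := by
  classical
  -- Specialize the times so that h_1, h_2, … become independent variables.
  obtain ⟨t, ht⟩ := exists_completeHomogeneous_eq
    (fun n : ℕ => if n = 0 then 1 else (MvPolynomial.X n : MvPolynomial ℕ K)) (if_pos rfl)
  rw [linearIndependent_iff']
  intro S c hc
  by_contra hne
  push Not at hne
  obtain ⟨nu, hnu, hcnu⟩ := hne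
  obtain ⟨n, hn⟩ : ∃ n, ∀ lam ∈ S, lam.colLen 0 ≤ n :=
    ⟨S.sup fun lam => lam.colLen 0, fun lam h => Finset.le_sup (f := fun lam => lam.colLen 0) h⟩
  -- For λ minimizing ∑ λ_i² in the relation, the monomial ∏ h_{λ_i} occurs in no other s_μ of the
  -- relation.
  obtain ⟨lam, hlam, hmin⟩ := (S.filter fun lam => c lam ≠ 0).exists_min_image
    (fun lam => ∑ i : Fin n, lam.rowLen i ^ 2) ⟨nu, Finset.mem_filter.2 ⟨hnu, hcnu⟩⟩
  obtain ⟨hlamS, hclam⟩ := Finset.mem_filter.1 hlam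
  have h := congrArg (MvPolynomial.aeval t) hc
  rw [map_sum, map_zero] at h
  rw [Finset.sum_congr rfl fun mu _ => by rw [map_smul, aeval_schurFunction]] at h
  have h' := congrArg (MvPolynomial.coeff (partsExponent fun i : Fin n => lam.rowLen i)) h
  rw [MvPolynomial.coeff_sum, MvPolynomial.coeff_zero, Finset.sum_eq_single lam] at h'
  · rw [MvPolynomial.coeff_smul, coeff_partsExponent_schurFunction ht (hn _ hlamS) (hn _ hlamS)
      le_rfl, if_pos rfl, smul_eq_mul, mul_one] at h'
    exact hclam h'
  · intro mu hmu hne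
    rw [MvPolynomial.coeff_smul]
    by_cases hcmu : c mu = 0
    · rw [hcmu, zero_smul]
    · rw [coeff_partsExponent_schurFunction ht (hn _ hlamS) (hn _ hmu)
        (hmin mu (Finset.mem_filter.2 ⟨hmu, hcmu⟩)), if_neg (Ne.symm hne), smul_zero]
  · intro h
    exact absurd hlamS h

theorem coeff_bosonize (c : YoungDiagram → K) (m : ℕ+ →₀ ℕ) :
    MvPowerSeries.coeff m (bosonize c) =
      ∑ lam ∈ (YoungDiagram.finite_card_eq (Finsupp.weight (fun i : ℕ+ => (i : ℕ)) m)).toFinset,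
        c lam * MvPolynomial.coeff m
          (schurFunction (A := MvPolynomial ℕ+ K) MvPolynomial.X lam) := by
  change ∑ᶠ lam : YoungDiagram, c lam * MvPowerSeries.coeff m (fermionToBoson K lam) = _
  simp only [fermionToBoson_eq_schurFunction, coeff_schurFunction]
  refine finsum_eq_sum_of_support_subset _ fun lam hlam => ?_
  rw [Set.Finite.coe_toFinset, Set.mem_ofPred_eq]
  by_contra h
  refine hlam ?_
  beta_reduce
  rw [(isWeightedHomogeneous_schurFunction lam).coeff_eq_zero m (Ne.symm h), mul_zero]

/-- Homogeneity separates the diagrams by size, and each size has finitely many, so linear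
independence of finite families settles the infinite sum. -/
theorem bosonize_injective : Function.Injective (bosonize (K := K)) := by
  intro c c' h
  ext lam
  have hS : lam ∈ (YoungDiagram.finite_card_eq lam.card).toFinset :=
    (Set.Finite.mem_toFinset _).2 rfl
  refine sub_eq_zero.1 (linearIndependent_iff'.1 (linearIndependent_schurFunction (K := K))
    (YoungDiagram.finite_card_eq lam.card).toFinset (fun mu => c mu - c' mu) ?_ lam hS)
  ext m
  rw [MvPolynomial.coeff_sum, MvPolynomial.coeff_zero]
  simp only [MvPolynomial.coeff_smul, smul_eq_mul]
  by_cases hm : Finsupp.weight (fun i : ℕ+ => (i : ℕ)) m = lam.card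
  · have h' := congrArg (MvPowerSeries.coeff m) h
    rw [coeff_bosonize, coeff_bosonize, hm] at h'
    simp only [sub_mul, Finset.sum_sub_distrib, h', sub_self]
  · refine Finset.sum_eq_zero fun mu hmu => ?_
    rw [Set.Finite.mem_toFinset, Set.mem_ofPred_eq] at hmu
    rw [(isWeightedHomogeneous_schurFunction mu).coeff_eq_zero m (hmu ▸ hm), mul_zero]

end SchurFunctions

/-! ### Recovering a subspace from its Plücker coordinates -/

section Pluecker

variable {K : Type*} [Field K]

/-- The hook with arm length `m - 1` and leg length `k`. -/
def YoungDiagram.hook (m k : ℕ) : YoungDiagram where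
  cells := {0} ×ˢ Finset.range m ∪ Finset.range (k + 1) ×ˢ {0}
  isLowerSet := by
    rintro ⟨i, j⟩ ⟨i', j'⟩ ⟨hi, hj⟩ h
    simp only [Finset.coe_union, Finset.coe_product, Set.mem_union, Set.mem_prod, Finset.mem_coe,
      Finset.mem_singleton, Finset.mem_range] at h hi hj ⊢
    omega

theorem YoungDiagram.mem_hook {m k i j : ℕ} :
    (i, j) ∈ YoungDiagram.hook m k ↔ i = 0 ∧ j < m ∨ i ≤ k ∧ j = 0 := by
  rw [← YoungDiagram.mem_cells]
  simp only [YoungDiagram.hook, Finset.mem_union, Finset.mem_product, Finset.mem_singleton,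
    Finset.mem_range]
  omega

theorem YoungDiagram.colLen_hook {m k : ℕ} : (YoungDiagram.hook m k).colLen 0 = k + 1 := by
  refine eq_of_forall_lt_iff fun i => ?_
  rw [← YoungDiagram.mem_iff_lt_colLen, YoungDiagram.mem_hook]
  omega

theorem YoungDiagram.rowLen_hook {m k : ℕ} (hm : 0 < m) (i : ℕ) :
    (YoungDiagram.hook m k).rowLen i = if i = 0 then m else if i ≤ k then 1 else 0 := by
  refine eq_of_forall_lt_iff fun j => ?_
  rw [← YoungDiagram.mem_iff_lt_rowLen, YoungDiagram.mem_hook]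
  split_ifs <;> omega

/-- The square matrix of coefficients of `w_0, …, w_{n-1}` at the given exponents. -/
noncomputable def coeffMatrix (w : ℕ → LaurentSeries K) {n : ℕ} (e : Fin n → ℤ) :
    Matrix (Fin n) (Fin n) K :=
  Matrix.of fun i j => (w j).coeff (e i)

/-- `w_k = x^{-k} + ⋯` for `k ≥ N`, and `w_k ∈ x^{1-N} K[[x]]` for `k < N`. -/
def IsAdmissibleFrom (N : ℕ) (w : ℕ → LaurentSeries K) : Prop :=
  (∀ k, N ≤ k → (w k).coeff (-(k : ℤ)) = 1 ∧ ∀ m : ℤ, m < -(k : ℤ) → (w k).coeff m = 0) ∧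
    ∀ k, k < N → ∀ m : ℤ, m ≤ -(N : ℤ) → (w k).coeff m = 0

theorem IsAdmissibleFrom.mono {N n : ℕ} {w : ℕ → LaurentSeries K} (h : IsAdmissibleFrom N w)
    (hn : N ≤ n) : IsAdmissibleFrom n w := by
  refine ⟨fun k hk => h.1 k (hn.trans hk), fun k hk m hm => ?_⟩
  rcases lt_or_ge k N with h' | h'
  · exact h.2 k h' m (by omega)
  · exact (h.1 k h').2 m (by omega)

/-- Past N and the length of the diagram, each new last row is (0, …, 0, 1): the minors are already
stable. -/
theorem infiniteWedge_eq_det {N : ℕ} {w : ℕ → LaurentSeries K} (h : IsAdmissibleFrom N w)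
    (lam : YoungDiagram) (hlam : lam.colLen 0 ≤ N) :
    infiniteWedge w lam =
      (coeffMatrix w fun i : Fin N => (lam.rowLen i : ℤ) - (i : ℕ)).det := by
  refine eventualValue_eq (Filter.eventually_atTop.2 ⟨N, fun n hn => ?_⟩)
  induction n, hn using Nat.le_induction with
  | base => rfl
  | succ n hn ih =>
    rw [← ih, Matrix.det_of_last_row]
    · rfl
    · intro j
      rw [Matrix.of_apply, Fin.val_last, YoungDiagram.rowLen_eq_zero (hlam.trans hn)]
      exact (h.mono hn).2 _ j.2 _ (by simp)
    · rw [Matrix.of_apply, Fin.val_last, YoungDiagram.rowLen_eq_zero (hlam.trans hn)]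
      simpa using (h.1 n hn).1

/-- `∑_j adj(A)_{jk} w_j`, where `A` is the matrix of coefficients at `0, -1, …, 1 - n`. -/
noncomputable def adjugateVec (w : ℕ → LaurentSeries K) {n : ℕ} (k : Fin n) : LaurentSeries K :=
  ∑ j : Fin n, (coeffMatrix w fun i : Fin n => -((i : ℕ) : ℤ)).adjugate j k • w j

/-- Cramer's rule. All coefficients of these vectors are minors, hence depend only on Plücker
coordinates. -/
theorem coeff_adjugateVec (w : ℕ → LaurentSeries K) {n : ℕ} (k : Fin n) (m : ℤ) :
    (adjugateVec w k).coeff m =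
      (coeffMatrix w (Function.update (fun i : Fin n => -((i : ℕ) : ℤ)) k m)).det := by
  set A := coeffMatrix w fun i : Fin n => -((i : ℕ) : ℤ) with hA
  have h : coeffMatrix w (Function.update (fun i : Fin n => -((i : ℕ) : ℤ)) k m) =
      A.updateRow k fun j => (w j).coeff m := by
    ext i j
    by_cases hi : i = k
    · subst hi
      simp [coeffMatrix]
    · rw [Matrix.updateRow_ne hi, hA, coeffMatrix, coeffMatrix, Matrix.of_apply, Matrix.of_apply,
        Function.update_of_ne hi]
  rw [h, ← Matrix.cramer_transpose_apply, Matrix.cramer_eq_adjugate_mulVec,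
    ← Matrix.adjugate_transpose, adjugateVec, HahnSeries.coeff_sum]
  rfl

theorem adjugateVec_mem_span (w : ℕ → LaurentSeries K) {n : ℕ} (k : Fin n) :
    adjugateVec w k ∈ Submodule.span K (Set.range w) :=
  Submodule.sum_mem _ fun j _ => Submodule.smul_mem _ _ (Submodule.subset_span ⟨j, rfl⟩)

/-- From adj(A) A = det(A): when the coordinate at the empty diagram is nonzero, the adjugate
vectors span the same space as w_0, …, w_{n-1}. -/
theorem sum_smul_adjugateVec (w : ℕ → LaurentSeries K) {n : ℕ} (j : Fin n) :
    ∑ k : Fin n, (w j).coeff (-((k : ℕ) : ℤ)) • adjugateVec w k =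
      (coeffMatrix w fun i : Fin n => -((i : ℕ) : ℤ)).det • w j := by
  set A := coeffMatrix w fun i : Fin n => -((i : ℕ) : ℤ) with hA
  simp only [adjugateVec, Finset.smul_sum, smul_smul]
  rw [Finset.sum_comm]
  have h : ∀ i : Fin n, ∑ k : Fin n, ((w j).coeff (-((k : ℕ) : ℤ)) * A.adjugate i k) • w i =
      (if i = j then A.det else 0) • w i := by
    intro i
    rw [← Finset.sum_smul]
    congr 1
    have h1 := congrFun (congrFun (Matrix.adjugate_mul A) i) j
    rw [Matrix.mul_apply, Matrix.smul_apply, Matrix.one_apply, smul_eq_mul, mul_ite, mul_one,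
      mul_zero] at h1
    rw [← h1]
    exact Finset.sum_congr rfl fun k _ => mul_comm _ _
  rw [Finset.sum_congr rfl fun i _ => h i]
  simp

theorem det_coeffMatrix_comp_perm (w : ℕ → LaurentSeries K) {n : ℕ} (e : Fin n → ℤ)
    (σ : Equiv.Perm (Fin n)) :
    (coeffMatrix w (e ∘ σ)).det = Equiv.Perm.sign σ * (coeffMatrix w e).det := by
  rw [← Matrix.det_permute]
  rfl

/-- Replacing -k by m > 0 and moving m to the front gives m, 0, …, 1-k, -k-1, …, the exponents of
the hook (m, 1^k). -/
theorem hook_exponents_comp_cycleRange {m n : ℕ} (hm : 0 < m) (k : Fin n) :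
    Function.update (fun i : Fin n => -((i : ℕ) : ℤ)) k m =
      (fun i : Fin n => ((YoungDiagram.hook m k).rowLen i : ℤ) - (i : ℕ)) ∘ k.cycleRange := by
  have : NeZero n := ⟨by have := k.2; omega⟩
  funext i
  rw [Function.comp_apply, YoungDiagram.rowLen_hook hm]
  rcases lt_trichotomy i k with h | rfl | h
  · rw [Function.update_of_ne h.ne, Fin.coe_cycleRange_of_lt h, if_neg (Nat.succ_ne_zero _),
      if_pos (Nat.succ_le_of_lt h)]
    push_cast
    ring
  · rw [Function.update_self, Fin.cycleRange_self]
    simp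
  · have h' : (k : ℕ) < i := h
    rw [Function.update_of_ne h.ne', Fin.cycleRange_of_gt h, if_neg (by omega), if_neg (by omega)]
    simp

theorem infiniteWedge_bot {N : ℕ} {w : ℕ → LaurentSeries K} (h : IsAdmissibleFrom N w) :
    infiniteWedge w ⊥ = (coeffMatrix w fun i : Fin N => -((i : ℕ) : ℤ)).det := by
  have h0 : (⊥ : YoungDiagram).colLen 0 = 0 := by
    by_contra hne
    exact YoungDiagram.notMem_bot _ (YoungDiagram.mem_iff_lt_colLen.2 (Nat.pos_of_ne_zero hne))
  rw [infiniteWedge_eq_det h ⊥ (by omega)]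
  congr 2
  funext i
  rw [YoungDiagram.rowLen_eq_zero (by omega)]
  simp

theorem adjugateVec_eq_of_infiniteWedge_eq {n : ℕ} {w w' : ℕ → LaurentSeries K}
    (h : IsAdmissibleFrom n w) (h' : IsAdmissibleFrom n w')
    (he : infiniteWedge w = infiniteWedge w') (k : Fin n) : adjugateVec w k = adjugateVec w' k := by
  ext m
  rw [coeff_adjugateVec, coeff_adjugateVec]
  -- For m > 0 the minor is a hook coordinate up to sign. For m ≤ -n a row vanishes. In between,
  -- either m = -k gives the empty diagram, or two rows coincide.
  rcases lt_or_ge 0 m with hm | hm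
  · lift m to ℕ using hm.le
    have hcol : (YoungDiagram.hook m k).colLen 0 ≤ n := by
      rw [YoungDiagram.colLen_hook]
      exact k.2
    rw [hook_exponents_comp_cycleRange (by omega), det_coeffMatrix_comp_perm,
      det_coeffMatrix_comp_perm, ← infiniteWedge_eq_det h _ hcol, he,
      infiniteWedge_eq_det h' _ hcol]
  rcases le_or_gt m (-(n : ℤ)) with hn | hn
  · have hz : ∀ {v : ℕ → LaurentSeries K}, IsAdmissibleFrom n v →
        (coeffMatrix v (Function.update (fun i : Fin n => -((i : ℕ) : ℤ)) k m)).det = 0 := by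
      intro v hv
      refine Matrix.det_eq_zero_of_row_eq_zero k fun j => ?_
      rw [coeffMatrix, Matrix.of_apply, Function.update_self]
      exact hv.2 j j.2 m hn
    rw [hz h, hz h']
  obtain ⟨i, rfl⟩ : ∃ i : Fin n, m = -((i : ℕ) : ℤ) := ⟨⟨(-m).toNat, by omega⟩, by simp; omega⟩
  by_cases hik : i = k
  · subst hik
    rw [Function.update_eq_self i fun i : Fin n => -((i : ℕ) : ℤ), ← infiniteWedge_bot h,
      ← infiniteWedge_bot h', he]
  · have hz : ∀ v : ℕ → LaurentSeries K, (coeffMatrix v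
        (Function.update (fun i : Fin n => -((i : ℕ) : ℤ)) k (-((i : ℕ) : ℤ)))).det = 0 := by
      intro v
      refine Matrix.det_zero_of_row_eq hik (funext fun j => ?_)
      rw [coeffMatrix, Matrix.of_apply, Matrix.of_apply, Function.update_self,
        Function.update_of_ne hik]
    rw [hz, hz]

theorem span_le_of_infiniteWedge_eq {N : ℕ} {w w' : ℕ → LaurentSeries K}
    (h : IsAdmissibleFrom N w) (h' : IsAdmissibleFrom N w')
    (he : infiniteWedge w = infiniteWedge w') (h0 : infiniteWedge w ⊥ ≠ 0) :
    Submodule.span K (Set.range w) ≤ Submodule.span K (Set.range w') := by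
  rw [Submodule.span_le]
  rintro _ ⟨j, rfl⟩
  have hn := h.mono (n := max N (j + 1)) (le_max_left _ _)
  have hn' := h'.mono (n := max N (j + 1)) (le_max_left _ _)
  rw [infiniteWedge_bot hn] at h0
  have hsum := sum_smul_adjugateVec w (⟨j, (le_max_right N (j + 1))⟩ : Fin (max N (j + 1)))
  rw [SetLike.mem_coe, ← Submodule.smul_mem_iff _ h0]
  rw [← hsum]
  refine Submodule.sum_mem _ fun k _ => Submodule.smul_mem _ _ ?_
  rw [adjugateVec_eq_of_infiniteWedge_eq hn hn' he]
  exact adjugateVec_mem_span w' k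

/-- The Plücker coordinates determine the subspace. -/
theorem span_eq_of_infiniteWedge_eq {w w' : ℕ → LaurentSeries K}
    {W W' : Submodule K (LaurentSeries K)} (h : IsAdmissibleBasis w W) (h' : IsAdmissibleBasis w' W')
    (he : infiniteWedge w = infiniteWedge w') (h0 : infiniteWedge w ⊥ ≠ 0) : W = W' := by
  obtain ⟨-, rfl, N, hN⟩ := h
  obtain ⟨-, rfl, N', hN'⟩ := h'
  have hw : IsAdmissibleFrom (max N N') w := IsAdmissibleFrom.mono hN (le_max_left _ _)
  have hw' : IsAdmissibleFrom (max N N') w' := IsAdmissibleFrom.mono hN' (le_max_right _ _)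
  exact (span_le_of_infiniteWedge_eq hw hw' he h0).antisymm
    (span_le_of_infiniteWedge_eq hw' hw he.symm (he ▸ h0))

end Pluecker

/-! ### Bases with leading terms 1, x⁻¹, x⁻², … -/

section Triangular

variable {K : Type*} [Field K] {w : ℕ → LaurentSeries K}

/-- If k is the largest index in the combination, only w_k reaches x^{-k}, so its coefficient must
vanish. -/
theorem IsAdmissibleFrom.eq_zero_of_mem_positivePart (h : IsAdmissibleFrom 0 w) (c : ℕ →₀ K)
    (hc : Finsupp.linearCombination K w c ∈ positivePart K) : c = 0 := by
  by_contra hne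
  obtain ⟨k, hk, hmax⟩ := c.support.exists_max_image id (Finsupp.support_nonempty_iff.2 hne)
  have h0 := hc (-(k : ℤ)) (by omega)
  rw [Finsupp.linearCombination_apply, Finsupp.sum, HahnSeries.coeff_sum,
    Finset.sum_eq_single k] at h0
  · rw [HahnSeries.coeff_smul, (h.1 k (Nat.zero_le k)).1, smul_eq_mul, mul_one] at h0
    exact Finsupp.mem_support_iff.1 hk h0
  · intro j hj hjk
    have hlt : j < k := lt_of_le_of_ne (hmax j hj) hjk
    rw [HahnSeries.coeff_smul, (h.1 j (Nat.zero_le j)).2 _ (by omega), smul_zero]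
  · intro hk'
    exact absurd hk hk'

theorem IsAdmissibleFrom.linearIndependent (h : IsAdmissibleFrom 0 w) : LinearIndependent K w := by
  rw [linearIndependent_iff]
  intro c hc
  exact h.eq_zero_of_mem_positivePart c (hc ▸ Submodule.zero_mem _)

/-- The terms of nonpositive degree are cancelled one at a time, starting with the deepest pole. -/
theorem IsAdmissibleFrom.exists_sub_mem_positivePart (h : IsAdmissibleFrom 0 w)
    (f : LaurentSeries K) : ∃ g ∈ Submodule.span K (Set.range w), f - g ∈ positivePart K := by
  obtain ⟨n, hn⟩ : ∃ n : ℕ, ∀ m : ℤ, m ≤ -(n : ℤ) → f.coeff m = 0 :=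
    ⟨(1 - f.order).toNat, fun m hm => HahnSeries.coeff_eq_zero_of_lt_order (by omega)⟩
  induction n generalizing f with
  | zero => exact ⟨0, Submodule.zero_mem _, fun m hm => by rw [sub_zero]; exact hn m (by omega)⟩
  | succ n ih =>
    obtain ⟨g, hg, hfg⟩ := ih (f - f.coeff (-(n : ℤ)) • w n) fun m hm => by
      rw [HahnSeries.coeff_sub, HahnSeries.coeff_smul]
      rcases hm.lt_or_eq with hlt | rfl
      · rw [hn m (by omega), (h.1 n (Nat.zero_le n)).2 m hlt, smul_zero, sub_zero]
      · rw [(h.1 n (Nat.zero_le n)).1, smul_eq_mul, mul_one, sub_self]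
    refine ⟨f.coeff (-(n : ℤ)) • w n + g, Submodule.add_mem _ (Submodule.smul_mem _ _
      (Submodule.subset_span ⟨n, rfl⟩)) hg, ?_⟩
    rwa [← sub_sub]

theorem IsAdmissibleFrom.span_mem_satoGrassmannian (h : IsAdmissibleFrom 0 w) :
    Submodule.span K (Set.range w) ∈ SatoGrassmannian K := by
  have hker : LinearMap.ker (grProj (Submodule.span K (Set.range w))) = ⊥ := by
    rw [LinearMap.ker_eq_bot']
    rintro ⟨f, hf⟩ h0
    have h0' : f ∈ positivePart K := (Submodule.Quotient.mk_eq_zero _).1 h0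
    obtain ⟨c, rfl⟩ := (Finsupp.mem_span_range_iff_exists_finsupp).1 hf
    refine Subtype.ext ?_
    change c.sum (fun i a => a • w i) = 0
    rw [h.eq_zero_of_mem_positivePart c h0', Finsupp.sum_zero_index]
  have hrange : LinearMap.range (grProj (Submodule.span K (Set.range w))) = ⊤ := by
    rw [LinearMap.range_eq_top]
    intro q
    obtain ⟨f, rfl⟩ := Submodule.mkQ_surjective _ q
    obtain ⟨g, hg, hfg⟩ := h.exists_sub_mem_positivePart f
    exact ⟨⟨g, hg⟩, ((Submodule.Quotient.eq _).2 hfg).symm⟩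
  change FiniteDimensional K _ ∧ FiniteDimensional K _ ∧ _
  rw [hker, hrange]
  have : Subsingleton ((LaurentSeries K ⧸ positivePart K) ⧸
      (⊤ : Submodule K (LaurentSeries K ⧸ positivePart K))) :=
    Submodule.Quotient.subsingleton_iff.2 rfl
  exact ⟨inferInstance, inferInstance, by rw [finrank_bot, Module.finrank_zero_of_subsingleton]⟩

theorem IsAdmissibleFrom.isAdmissibleBasis (h : IsAdmissibleFrom 0 w) :
    IsAdmissibleBasis w (Submodule.span K (Set.range w)) :=
  ⟨h.linearIndependent, rfl, 0, h⟩

theorem IsAdmissibleFrom.infiniteWedge_bot_eq_one (h : IsAdmissibleFrom 0 w) :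
    infiniteWedge w ⊥ = 1 := by
  rw [infiniteWedge_bot h, Matrix.det_fin_zero]

end Triangular

/-! ### Gamma factors, the content weight, and the main theorem -/

section DoubleMonotoneHurwitz

variable {β : ℂ}

theorem Gamma_intCast_sub_inv_ne_zero (hβ : ∀ n : ℤ, β⁻¹ ≠ n) (m : ℤ) :
    Complex.Gamma (m - β⁻¹) ≠ 0 := by
  refine Complex.Gamma_ne_zero fun n hn => hβ (m + n) ?_
  push_cast
  linear_combination -hn

/-- The factor `(-β)^{-m} / Γ(m - β⁻¹)` of `G_mm(k)` at `D = m`. -/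
noncomputable def gammaFactor (β : ℂ) (m : ℤ) : ℂ :=
  (-β) ^ (-m) / Complex.Gamma (m - β⁻¹)

theorem gammaFactor_ne_zero (hβ0 : β ≠ 0) (hβ : ∀ n : ℤ, β⁻¹ ≠ n) (m : ℤ) :
    gammaFactor β m ≠ 0 :=
  div_ne_zero (zpow_ne_zero _ (neg_ne_zero.2 hβ0)) (Gamma_intCast_sub_inv_ne_zero hβ m)

theorem gammaFactor_add_one (hβ0 : β ≠ 0) (hβ : ∀ n : ℤ, β⁻¹ ≠ n) (m : ℤ) :
    gammaFactor β (m + 1) = gammaFactor β m * (1 / (1 - β * m)) := by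
  have h1 : (m : ℂ) - β⁻¹ ≠ 0 := sub_ne_zero.2 (hβ m).symm
  have h2 : 1 - β * (m : ℂ) = -β * (m - β⁻¹) := by
    rw [mul_sub, neg_mul, neg_mul, mul_inv_cancel₀ hβ0]
    ring
  have h3 : ((m + 1 : ℤ) : ℂ) - β⁻¹ = (m - β⁻¹) + 1 := by push_cast; ring
  rw [gammaFactor, gammaFactor, h2, h3, Complex.Gamma_add_one _ h1, neg_add,
    zpow_add₀ (neg_ne_zero.2 hβ0), zpow_neg_one]
  have := Gamma_intCast_sub_inv_ne_zero hβ m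
  field_simp

theorem gammaFactor_add_natCast (hβ0 : β ≠ 0) (hβ : ∀ n : ℤ, β⁻¹ ≠ n) (m : ℤ) (n : ℕ) :
    gammaFactor β (n + m) = gammaFactor β m *
      ∏ k ∈ Finset.range n, 1 / (1 + β * ((k : ℂ) + 1 - m - n)) := by
  have h : ∀ n : ℕ, gammaFactor β (n + m) = gammaFactor β m *
      ∏ k ∈ Finset.range n, 1 / (1 - β * ((k : ℂ) + m)) := by
    intro n
    induction n with
    | zero => simp
    | succ n ih =>
      rw [Finset.prod_range_succ, ← mul_assoc, ← ih,
        show ((n + 1 : ℕ) : ℤ) + m = (n + m : ℤ) + 1 by push_cast; ring,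
        gammaFactor_add_one hβ0 hβ]
      push_cast
      rfl
  -- Reversing k ↦ n - 1 - k matches the order of the factors in `monotoneWeight`.
  rw [h, ← Finset.prod_range_reflect]
  congr 1
  refine Finset.prod_congr rfl fun k hk => ?_
  have hk' := Finset.mem_range.1 hk
  rw [Nat.sub_sub, Nat.cast_sub (by omega)]
  push_cast
  congr 1
  ring

/-- The dependence on k and on the exponent m separates. This is what makes G_mm(k) a rescaling of
the rows and columns of minors. -/
theorem gMM_eq (hβ0 : β ≠ 0) (k m : ℤ) :
    gMM β k m = gammaFactor β m * (gammaFactor β (1 - k))⁻¹ := by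
  rw [gMM, gammaFactor, gammaFactor, sub_eq_add_neg (1 - k) m, zpow_add₀ (neg_ne_zero.2 hβ0),
    inv_div, zpow_neg (-β) (1 - k), div_inv_eq_mul]
  push_cast
  ring

theorem monotoneWeight_eq (hβ0 : β ≠ 0) (hβ : ∀ n : ℤ, β⁻¹ ≠ n) (lam : YoungDiagram) :
    monotoneWeight β lam = ∏ i : Fin (lam.colLen 0),
      gammaFactor β ((lam.rowLen i : ℤ) - (i : ℕ)) * (gammaFactor β (-((i : ℕ) : ℤ)))⁻¹ := by
  have h : Finset.Icc 1 (lam.colLen 0) = Finset.Ico (0 + 1) (lam.colLen 0 + 1) := by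
    ext i
    simp
  rw [monotoneWeight, h, ← Finset.prod_Ico_add', ← Finset.range_eq_Ico,
    ← Fin.prod_univ_eq_prod_range]
  refine Finset.prod_congr rfl fun i _ => ?_
  rw [sub_eq_add_neg, gammaFactor_add_natCast hβ0 hβ, mul_comm (gammaFactor β _),
    mul_inv_cancel_right₀ (gammaFactor_ne_zero hβ0 hβ _), Nat.add_sub_cancel]
  refine Finset.prod_congr rfl fun k _ => ?_
  push_cast
  congr 1
  ring

variable {K : Type*} [Field K] [Algebra ℂ K]

theorem coeff_PhiMM (β : ℂ) (tt : ℕ+ → K) (k : ℕ) (m : ℤ) :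
    (PhiMM β tt k).coeff m =
      algebraMap ℂ K (gMM β k m) * completeHomogeneous tt (m + k - 1) := by
  change algebraMap ℂ K (gMM β k m) * (HahnSeries.ofPowerSeries ℤ K (expTimes tt) *
    HahnSeries.single (1 - (k : ℤ)) 1).coeff m = _
  congr 1
  have h := HahnSeries.coeff_mul_single_add (r := (1 : K))
    (x := HahnSeries.ofPowerSeries ℤ K (expTimes tt)) (a := m + k - 1) (b := 1 - (k : ℤ))
  rw [show m + k - 1 + (1 - (k : ℤ)) = m by ring, mul_one] at h
  rw [h, completeHomogeneous]
  refine (PowerSeries.coeff_coe _ _).trans ?_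
  split_ifs with h1 h2 h2
  · omega
  · rfl
  · rw [show (m + k - 1).natAbs = (m + k - 1).toNat by omega]
  · omega

theorem isAdmissibleFrom_PhiMM (hβ0 : β ≠ 0) (hβ : ∀ n : ℤ, β⁻¹ ≠ n) (tt : ℕ+ → K) :
    IsAdmissibleFrom 0 fun k : ℕ => PhiMM β tt (k + 1) := by
  refine ⟨fun k _ => ⟨?_, fun m hm => ?_⟩, fun k hk => absurd hk (Nat.not_lt_zero k)⟩
  · rw [coeff_PhiMM, gMM_eq hβ0, show (1 : ℤ) - ((k + 1 : ℕ) : ℤ) = -k by push_cast; ring,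
      mul_inv_cancel₀ (gammaFactor_ne_zero hβ0 hβ _), map_one, one_mul,
      show -(k : ℤ) + ((k + 1 : ℕ) : ℤ) - 1 = 0 by push_cast; ring, completeHomogeneous_zero]
  · rw [coeff_PhiMM, completeHomogeneous_of_neg _ (by push_cast; omega), mul_zero]

theorem infiniteWedge_PhiMM (hβ0 : β ≠ 0) (hβ : ∀ n : ℤ, β⁻¹ ≠ n) (tt : ℕ+ → K)
    (lam : YoungDiagram) :
    infiniteWedge (fun k : ℕ => PhiMM β tt (k + 1)) lam =
      schurFunction tt lam * algebraMap ℂ K (monotoneWeight β lam) := by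
  rw [infiniteWedge_eq_det ((isAdmissibleFrom_PhiMM hβ0 hβ tt).mono (Nat.zero_le _)) lam le_rfl,
    monotoneWeight_eq hβ0 hβ, Finset.prod_mul_distrib, map_mul, map_prod, map_prod, mul_comm,
    mul_comm (∏ i, _), mul_assoc]
  -- The factors c(λ_i - i) go into the rows of the Jacobi-Trudi matrix and 1/c(-j) into its
  -- columns.
  rw [schurFunction, ← Matrix.det_mul_column, ← Matrix.det_mul_row]
  congr 1
  ext i j
  rw [coeffMatrix, Matrix.of_apply, Matrix.of_apply, Matrix.of_apply, Matrix.of_apply, coeff_PhiMM,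
    gMM_eq hβ0, map_mul, show (1 : ℤ) - (((j : ℕ) + 1 : ℕ) : ℤ) = -(j : ℕ) by push_cast; ring,
    mul_left_comm, mul_assoc]
  congr 3
  push_cast
  ring

theorem tauMM_eq_bosonize (hβ0 : β ≠ 0) (hβ : ∀ n : ℤ, β⁻¹ ≠ n) (tt : ℕ+ → K) :
    tauMM β tt = bosonize (infiniteWedge fun k : ℕ => PhiMM β tt (k + 1)) := by
  ext m
  refine finsum_congr fun lam => ?_
  rw [fermionToBoson_eq_schurFunction, infiniteWedge_PhiMM hβ0 hβ]
  ring

end DoubleMonotoneHurwitz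

theorem mainTheorem4 {K : Type*} [Field K] [Algebra ℂ K] (β : ℂ) (hβ0 : β ≠ 0)
    (hβ : ∀ n : ℤ, β⁻¹ ≠ n) (tt : ℕ+ → K) :
    (∀ k : ℕ, 1 ≤ k → (PhiMM β tt k).coeff (1 - (k : ℤ)) = 1 ∧
      ∀ m : ℤ, m < 1 - (k : ℤ) → (PhiMM β tt k).coeff m = 0) ∧
    IsAdmissibleBasis (fun k : ℕ => PhiMM β tt (k + 1))
      (Submodule.span K {f | ∃ k : ℕ, 1 ≤ k ∧ f = PhiMM β tt k}) ∧
    Submodule.span K {f | ∃ k : ℕ, 1 ≤ k ∧ f = PhiMM β tt k} ∈ SatoGrassmannian K ∧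
    tauMM β tt = bosonize (infiniteWedge fun k : ℕ => PhiMM β tt (k + 1)) ∧
    ∀ W ∈ SatoGrassmannian K, IsTauFunction (tauMM β tt) W ↔
      W = Submodule.span K {f | ∃ k : ℕ, 1 ≤ k ∧ f = PhiMM β tt k} := by
  have hA := isAdmissibleFrom_PhiMM hβ0 hβ tt
  have hτ := tauMM_eq_bosonize hβ0 hβ tt
  have hset : {f | ∃ k : ℕ, 1 ≤ k ∧ f = PhiMM β tt k} =
      Set.range fun k : ℕ => PhiMM β tt (k + 1) := by
    ext f
    constructor
    · rintro ⟨k, hk, rfl⟩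
      exact ⟨k - 1, by beta_reduce; rw [Nat.sub_add_cancel hk]⟩
    · rintro ⟨k, rfl⟩
      exact ⟨k + 1, Nat.le_add_left 1 k, rfl⟩
  rw [hset]
  refine ⟨fun k hk => ?_, hA.isAdmissibleBasis, hA.span_mem_satoGrassmannian, hτ, fun W _ => ?_⟩
  · obtain ⟨n, rfl⟩ : ∃ n, k = n + 1 := ⟨k - 1, by omega⟩
    have h := hA.1 n (Nat.zero_le n)
    rwa [show (1 : ℤ) - ((n + 1 : ℕ) : ℤ) = -(n : ℤ) by push_cast; ring]
  · constructor
    · rintro ⟨w, hw, hwτ⟩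
      -- The two tau-functions are equal, not just proportional, so the Plücker coordinates agree
      -- exactly.
      have he := bosonize_injective (hτ.symm.trans hwτ)
      refine (span_eq_of_infiniteWedge_eq hA.isAdmissibleBasis hw he ?_).symm
      rw [hA.infiniteWedge_bot_eq_one]
      exact one_ne_zero
    · rintro rfl
      exact ⟨_, hA.isAdmissibleBasis, hτ⟩
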